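/- Fix $\hbar,\mu,V_0,R>0$, $\alpha\in\mathbb R$, $\beta\in\mathbb R\setminus\{2,-2\}$ and $\ell\in\mathbb N_0$. Put $v_0=\sqrt{2\mu R^2V_0/\hbar^2}$ and $w=4\alpha R$ (with spin-orbit coupling, $\alpha$ and hence $w=w_{\ell j}$ depend on $\ell$ and $j$). A bound state of energy $E\in(-V_0,0)$ is a nonzero $u\in L^2(0,\infty)$ with $u(0^+)=0$ that solves $$-u''+\frac{\ell(\ell+1)}{r^2}u+\frac{2\mu}{\hbar^2}\bigl(V(r)-E\bigr)u=0,\qquad r\in(0,R)\cup(R,\infty),$$ where $V=-V_0$ for $r<R$ and $V=0$ for $r>R$, and that satisfies the matching conditions of the $\delta$-$\delta'$ interaction $\alpha\,\delta(r-R)+\beta\,\delta'(r-R)$: $$u(R^+)=\tfrac{2+\beta}{2-\beta}\,u(R^-),\qquad u'(R^+)=\tfrac{4\alpha}{4-\beta^2}\,u(R^-)+\tfrac{2-\beta}{2+\beta}\,u'(R^-).$$ Its relative energy is $\varepsilon=|E|/V_0\in(0,1)$. Let $$\varphi_\ell(\chi)=\frac{\chi J_{\ell+3/2}(\chi)}{J_{\ell+1/2}(\chi)},\qquad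 \hat\varphi_\ell(\sigma)=\frac{(2+\beta)^2}{(2-\beta)^2}\,\frac{\sigma K_{\ell+3/2}(\sigma)}{K_{\ell+1/2}(\sigma)}-\frac{8\beta(\ell+1)}{(2-\beta)^2}+\frac{w}{(2-\beta)^2},$$ and let $j_{\lambda,s}$ be the $s$-th strictly positive zero of $J_\lambda$, with $j_{\lambda,0}=0$. (0) A number $\varepsilon\in(0,1)$ is the relative energy of a bound state if and only if, with $\chi=v_0\sqrt{1-\varepsilon}$ and $\sigma=v_0\sqrt{\varepsilon}$, one has $J_{\ell+1/2}(\chi)\neq0$ and $\varphi_\ell(\chi)=\hat\varphi_\ell(\sigma)$ (the secular equation). (1) If $w>-\bigl((\beta-2)^2+2\ell(\beta^2+4)\bigr)$, then for every integer $s\ge1$ with $j_{\ell+1/2,s}\le v_0$ the interval $$\left(1-\frac{j_{\ell+1/2,s}^2}{v_0^2},\;1-\frac{j_{\ell+3/2,s-1}^2}{v_0^2}\right)\subset(0,1)$$ contains exactly one relative energy of a bound state. (2) For every real $w$, the minimum $M=\min\{s\in\mathbb N_0: j_{\ell+1/2,s+1}>v_0\}$ and the limit $\hat\varphi_\ell(0^+)$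 exist. Assume that $\hat\varphi_\ell(v_0)\ne0$ and that $\varphi_\ell(v_0)\ne\hat\varphi_\ell(0^+)$ unless $v_0=j_{\ell+1/2,M}$. Then the number $n_\ell$ of relative energies in $(0,1)$ of bound states is finite and $$n_\ell=M+m-m',$$ where $m=1$ if $v_0\neq j_{\ell+1/2,M}$ and $\varphi_\ell(v_0)>\hat\varphi_\ell(0^+)$, and $m=0$ if $\varphi_\ell(v_0)<\hat\varphi_\ell(0^+)$ or $v_0=j_{\ell+1/2,M}$; $m'=1$ if $\hat\varphi_\ell(v_0)<0$, and $m'=0$ if $\hat\varphi_\ell(v_0)>0$. The number of bound states, each level being counted $2\ell+1$ times, is $N_\ell=(2\ell+1)n_\ell=(2\ell+1)(M+m-m')$. -/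

import Mathlib

open Set Filter Topology MeasureTheory

noncomputable section

/-- Bessel function of the first kind `J_ν(x)`, for real order and real argument `x > 0`,
by its power series. -/
def besselJ (ν x : ℝ) : ℝ :=
  (x / 2) ^ ν *
    ∑' k : ℕ, (-1 : ℝ) ^ k / ((k.factorial : ℝ) * Real.Gamma (ν + k + 1)) * (x / 2) ^ (2 * k)

/-- Modified Bessel function of the second kind `K_ν(x)`, for real order and `x > 0`,
by its integral representation. -/
def besselK (ν x : ℝ) : ℝ :=
  ∫ t in Ioi (0 : ℝ), Real.exp (-x * Real.cosh t) * Real.cosh (ν * t)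

/-- `besselJZero ν s` is `j_{ν,s}`, the `s`-th strictly positive zero of `J_ν`, with the
convention `j_{ν,0} = 0`: each zero is the smallest one beyond its predecessor. -/
def besselJZero (ν : ℝ) : ℕ → ℝ
  | 0 => 0
  | s + 1 => sInf {x : ℝ | besselJZero ν s < x ∧ besselJ ν x = 0}

/-- The left-hand side of the secular equation, `χ J_{ℓ+3/2}(χ) / J_{ℓ+1/2}(χ)`. -/
def secularLHS (ℓ : ℕ) (χ : ℝ) : ℝ :=
  χ * besselJ (ℓ + 3 / 2) χ / besselJ (ℓ + 1 / 2) χ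

/-- The right-hand side of the secular equation. -/
def secularRHS (ℓ : ℕ) (β w σ : ℝ) : ℝ :=
  (2 + β) ^ 2 / (2 - β) ^ 2 * (σ * besselK (ℓ + 3 / 2) σ / besselK (ℓ + 1 / 2) σ)
    - 8 * β * (ℓ + 1) / (2 - β) ^ 2 + w / (2 - β) ^ 2

/-- The data of a spherical square well of depth `V0` and radius `R`, for a particle of reduced
mass `mu`, with the contact term `α δ(r - R) + β δ'(r - R)` at its edge.  (In a channel `(ℓ, j)`
with spin-orbit coupling, `α = -2 mu V_so ξ_{ℓj} / hbar²`.) -/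
structure DeltaWell where
  hbar : ℝ
  mu : ℝ
  V0 : ℝ
  R : ℝ
  α : ℝ
  β : ℝ
  hbar_pos : 0 < hbar
  mu_pos : 0 < mu
  V0_pos : 0 < V0
  R_pos : 0 < R

namespace DeltaWell

/-- The dimensionless well strength. -/
def v0 (W : DeltaWell) : ℝ := √(2 * W.mu * W.R ^ 2 * W.V0 / W.hbar ^ 2)

/-- The dimensionless strength `w = 4 α R` of the `δ` term; for `α = -2 mu V_so ξ_{ℓj} / hbar²`
it is `-8 mu V_so ξ_{ℓj} R / hbar²`. -/
def w (W : DeltaWell) : ℝ := 4 * W.α * W.R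

/-- The regular part `V0 (θ(r - R) - 1)` of the potential. -/
def potential (W : DeltaWell) (r : ℝ) : ℝ := if r < W.R then -W.V0 else 0

/-- `u` is a reduced radial wave function of angular momentum `ℓ` and energy `E`: a nonzero
square-integrable solution of the radial Schrödinger equation on `(0, R) ∪ (R, ∞)`, vanishing at
the origin, whose one-sided limits at `R` obey the matching conditions that define the
`δ`-`δ'` interaction (for `β ≠ ±2`). -/
structure IsBoundState (W : DeltaWell) (ℓ : ℕ) (E : ℝ) (u : ℝ → ℂ) : Prop where
  nonzero : ∃ r, 0 < r ∧ r ≠ W.R ∧ u r ≠ 0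
  differentiable : ∀ r, 0 < r → r ≠ W.R → DifferentiableAt ℝ u r
  schrodinger : ∀ r, 0 < r → r ≠ W.R →
    HasDerivAt (deriv u)
      (((ℓ * (ℓ + 1) / r ^ 2 + 2 * W.mu / W.hbar ^ 2 * (W.potential r - E) : ℝ) : ℂ) * u r) r
  square_integrable : MemLp u 2 (volume.restrict (Ioi (0 : ℝ)))
  origin : Tendsto u (𝓝[>] 0) (𝓝 0)
  matching : ∃ a a' b b' : ℂ,
    Tendsto u (𝓝[<] W.R) (𝓝 a) ∧ Tendsto (deriv u) (𝓝[<] W.R) (𝓝 a') ∧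
    Tendsto u (𝓝[>] W.R) (𝓝 b) ∧ Tendsto (deriv u) (𝓝[>] W.R) (𝓝 b') ∧
    b = (((2 + W.β) / (2 - W.β) : ℝ) : ℂ) * a ∧
    b' = ((4 * W.α / (4 - W.β ^ 2) : ℝ) : ℂ) * a + (((2 - W.β) / (2 + W.β) : ℝ) : ℂ) * a'

/-- The relative energies `ε = |E| / V0 ∈ (0, 1)` of the bound states of angular momentum `ℓ`
with energy `E ∈ (-V0, 0)`. -/
def relativeEnergies (W : DeltaWell) (ℓ : ℕ) : Set ℝ :=
  {ε | ε ∈ Ioo (0 : ℝ) 1 ∧ ∃ u, W.IsBoundState ℓ (-(ε * W.V0)) u}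

/-- The number `n_ℓ` of energy levels of angular momentum `ℓ`. -/
def numLevels (W : DeltaWell) (ℓ : ℕ) : ℕ := (W.relativeEnergies ℓ).ncard

/-- The number `N_ℓ` of bound states of angular momentum `ℓ`, each level being counted with the
`2ℓ + 1` values of the magnetic quantum number. -/
def numBoundStates (W : DeltaWell) (ℓ : ℕ) : ℕ := (2 * ℓ + 1) * W.numLevels ℓ

end DeltaWell

end

/-! For half-integer order everything is elementary. Up to a positive factor independent of the
index, $J_{n+1/2}$ is the function $S_n$ obtained from $\sin$ by a three-term recurrence
(`besselJ_half_pair`). The quotients of consecutive $K_{n+1/2}$ equal those of the functions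
generated from $e^{-x}$ (`besselK_ratio_eq`).

Inside the well the radial equation has a regular and an irregular solution, and outside a decaying
and a growing one. Their Wronskians do not vanish, so they span all solutions. The condition at the
origin removes the irregular one and square integrability removes the growing one
(`IsBoundState.interior`, `IsBoundState.exterior`). Two amplitudes remain. Since $x S_n'/S_n = n+1 -
xS_{n+1}/S_n$, and likewise for the decaying solution, eliminating the amplitudes from the matching
conditions gives the secular equation. Conversely, a solution of it yields an explicit wave function
(`isBoundState_wave`).

The counting is a monotonicity argument. The derivative of $\varphi = xS_{n+1}/S_n$ is $Q/S_n^2$,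
where $Q' = 2S_n^2$ and $Q(0^+)=0$. So $\varphi$ increases between consecutive zeros of $S_n$, from
$-\infty$ (from $0$ on the first branch) to $+\infty$. The right-hand side $\hat\varphi$ increases
in $\sigma$ (`besselKRatio_strictMonoOn`), hence decreases in $\chi$ along $\chi^2+\sigma^2=v_0^2$.
The difference is therefore strictly increasing on each branch. It has at most one root there, and
the signs at the ends decide whether it has one: the first branch starts at $-\hat\varphi(v_0)$,
which gives $m'$, and a branch cut off at $v_0$ ends at $\varphi(v_0)-\hat\varphi(0^+)$, which gives
$m$ (`secularRoots_count`). If $\hat\varphi(0^+)>0$, the root lies where $\varphi>0$, that is, to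
the right of the zero of $S_{n+1}$ (`besselJZero_interlacing`, `secularRoots_interlaced`). -/

/-- Solutions of `y'' = (n (n + 1) / x ^ 2 - κ) y`, generated by the three-term recurrence from a
solution `f` of `f'' = -κ f` with derivative `f'`. -/
noncomputable def riccatiBessel (κ : ℝ) (f f' : ℝ → ℝ) : ℕ → ℝ → ℝ
  | 0 => f
  | 1 => fun x => f x / x - f' x
  | n + 2 => fun x =>
      (2 * n + 3) / x * riccatiBessel κ f f' (n + 1) x - κ * riccatiBessel κ f f' n x

/-- The derivative of `riccatiBessel`. -/
noncomputable def riccatiBesselDeriv (κ : ℝ) (f f' : ℝ → ℝ) (n : ℕ) (x : ℝ) : ℝ :=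
  (n + 1) / x * riccatiBessel κ f f' n x - riccatiBessel κ f f' (n + 1) x

/-! ### Riccati-Bessel functions: ladder relations, differential equation, Wronskians. -/

section RiccatiBessel

/-- The two ladder relations close on the pair of indices $(n, n+1)$: through the recurrence, the
second one at $n$ is the first one at $n+1$. -/
theorem riccatiBessel_hasDerivAt_pair {κ : ℝ} {f f' : ℝ → ℝ}
    (hf : ∀ x, HasDerivAt f (f' x) x) (hf' : ∀ x, HasDerivAt f' (-κ * f x) x)
    {x : ℝ} (hx : x ≠ 0) (n : ℕ) :
    HasDerivAt (riccatiBessel κ f f' n) (riccatiBesselDeriv κ f f' n x) x ∧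
    HasDerivAt (riccatiBessel κ f f' (n + 1))
      (κ * riccatiBessel κ f f' n x - (n + 1) / x * riccatiBessel κ f f' (n + 1) x) x := by
  induction n with
  | zero =>
    refine ⟨?_, ?_⟩
    · refine (hf x).congr_deriv ?_
      simp only [riccatiBesselDeriv, riccatiBessel]
      push_cast
      field_simp
      ring
    · refine (((hf x).fun_div (hasDerivAt_id' x) hx).fun_sub (hf' x)).congr_deriv ?_
      simp only [riccatiBessel]
      push_cast
      field_simp
      ring
  | succ n ih =>
    refine ⟨?_, ?_⟩
    · refine ih.2.congr_deriv ?_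
      simp only [riccatiBesselDeriv, riccatiBessel]
      push_cast
      field_simp
      ring
    · refine ((((hasDerivAt_const x (2 * (n : ℝ) + 3)).fun_div (hasDerivAt_id' x) hx).fun_mul
        ih.2).fun_sub (ih.1.const_mul κ)).congr_deriv ?_
      simp only [riccatiBesselDeriv, riccatiBessel]
      push_cast
      field_simp
      ring

theorem riccatiBessel_hasDerivAt {κ : ℝ} {f f' : ℝ → ℝ}
    (hf : ∀ x, HasDerivAt f (f' x) x) (hf' : ∀ x, HasDerivAt f' (-κ * f x) x)
    {x : ℝ} (hx : x ≠ 0) (n : ℕ) :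
    HasDerivAt (riccatiBessel κ f f' n) (riccatiBesselDeriv κ f f' n x) x :=
  (riccatiBessel_hasDerivAt_pair hf hf' hx n).1

theorem riccatiBesselDeriv_hasDerivAt {κ : ℝ} {f f' : ℝ → ℝ}
    (hf : ∀ x, HasDerivAt f (f' x) x) (hf' : ∀ x, HasDerivAt f' (-κ * f x) x)
    {x : ℝ} (hx : x ≠ 0) (n : ℕ) :
    HasDerivAt (riccatiBesselDeriv κ f f' n)
      ((n * (n + 1) / x ^ 2 - κ) * riccatiBessel κ f f' n x) x := by
  have h1 := riccatiBessel_hasDerivAt_pair hf hf' hx n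
  refine ((((hasDerivAt_const x ((n : ℝ) + 1)).fun_div (hasDerivAt_id' x) hx).fun_mul
    h1.1).fun_sub h1.2).congr_deriv ?_
  simp only [riccatiBesselDeriv]
  field_simp
  ring

/-- This is the Casoratian of two solutions of one recurrence. Each step multiplies it by $\kappa$,
and at $n=0$ the terms with $1/x$ cancel. -/
theorem riccatiBessel_cross (κ : ℝ) (f f' g g' : ℝ → ℝ) (x : ℝ) (n : ℕ) :
    riccatiBessel κ f f' n x * riccatiBessel κ g g' (n + 1) x -
      riccatiBessel κ f f' (n + 1) x * riccatiBessel κ g g' n x =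
      κ ^ n * (f' x * g x - f x * g' x) := by
  induction n with
  | zero => simp only [riccatiBessel]; ring
  | succ n ih =>
    rw [pow_succ, mul_right_comm, ← ih]
    simp only [riccatiBessel]
    ring

theorem riccatiBessel_wronskian (κ : ℝ) (f f' g g' : ℝ → ℝ) (x : ℝ) (n : ℕ) :
    riccatiBessel κ f f' n x * riccatiBesselDeriv κ g g' n x -
      riccatiBesselDeriv κ f f' n x * riccatiBessel κ g g' n x =
      -(κ ^ n * (f' x * g x - f x * g' x)) := by
  rw [← riccatiBessel_cross κ f f' g g' x n]
  simp only [riccatiBesselDeriv]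
  ring

/-- The regular Riccati-Bessel function. -/
noncomputable def riccatiS : ℕ → ℝ → ℝ := riccatiBessel 1 Real.sin Real.cos

/-- The derivative of `riccatiS`. -/
noncomputable def riccatiS' : ℕ → ℝ → ℝ := riccatiBesselDeriv 1 Real.sin Real.cos

/-- The Riccati-Bessel function that is irregular at the origin. -/
noncomputable def riccatiC : ℕ → ℝ → ℝ := riccatiBessel 1 Real.cos (fun x => -Real.sin x)

/-- The derivative of `riccatiC`. -/
noncomputable def riccatiC' : ℕ → ℝ → ℝ := riccatiBesselDeriv 1 Real.cos (fun x => -Real.sin x)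

/-- The modified Riccati-Bessel function that decays at infinity. -/
noncomputable def riccatiK : ℕ → ℝ → ℝ :=
  riccatiBessel (-1) (fun x => Real.exp (-x)) (fun x => -Real.exp (-x))

/-- The derivative of `riccatiK`. -/
noncomputable def riccatiK' : ℕ → ℝ → ℝ :=
  riccatiBesselDeriv (-1) (fun x => Real.exp (-x)) (fun x => -Real.exp (-x))

/-- A modified Riccati-Bessel function that grows at infinity. -/
noncomputable def riccatiI : ℕ → ℝ → ℝ := riccatiBessel (-1) Real.exp Real.exp

/-- The derivative of `riccatiI`. -/
noncomputable def riccatiI' : ℕ → ℝ → ℝ := riccatiBesselDeriv (-1) Real.exp Real.exp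

theorem hasDerivAt_exp_neg (x : ℝ) :
    HasDerivAt (fun x => Real.exp (-x)) (-Real.exp (-x)) x := by
  simpa using (hasDerivAt_neg x).exp

theorem riccatiS_hasDerivAt {x : ℝ} (hx : x ≠ 0) (n : ℕ) :
    HasDerivAt (riccatiS n) (riccatiS' n x) x :=
  riccatiBessel_hasDerivAt Real.hasDerivAt_sin
    (fun x => by simpa using Real.hasDerivAt_cos x) hx n

theorem riccatiS'_hasDerivAt {x : ℝ} (hx : x ≠ 0) (n : ℕ) :
    HasDerivAt (riccatiS' n) ((n * (n + 1) / x ^ 2 - 1) * riccatiS n x) x :=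
  riccatiBesselDeriv_hasDerivAt Real.hasDerivAt_sin
    (fun x => by simpa using Real.hasDerivAt_cos x) hx n

theorem riccatiS'_eq (n : ℕ) (x : ℝ) :
    riccatiS' n x = (n + 1) / x * riccatiS n x - riccatiS (n + 1) x := rfl

theorem riccatiS_succ_hasDerivAt {x : ℝ} (hx : x ≠ 0) (n : ℕ) :
    HasDerivAt (riccatiS (n + 1)) (riccatiS n x - (n + 1) / x * riccatiS (n + 1) x) x := by
  have := (riccatiBessel_hasDerivAt_pair (κ := 1) Real.hasDerivAt_sin
    (fun x => by simpa using Real.hasDerivAt_cos x) hx n).2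
  rwa [one_mul] at this

theorem riccatiS_zero (x : ℝ) : riccatiS 0 x = Real.sin x := rfl

theorem riccatiS_one (x : ℝ) : riccatiS 1 x = Real.sin x / x - Real.cos x := rfl

theorem riccatiS_add_two (n : ℕ) (x : ℝ) :
    riccatiS (n + 2) x = (2 * n + 3) / x * riccatiS (n + 1) x - riccatiS n x := by
  simp [riccatiS, riccatiBessel]

theorem riccatiC_hasDerivAt {x : ℝ} (hx : x ≠ 0) (n : ℕ) :
    HasDerivAt (riccatiC n) (riccatiC' n x) x :=
  riccatiBessel_hasDerivAt Real.hasDerivAt_cos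
    (fun x => by simpa using (Real.hasDerivAt_sin x).fun_neg) hx n

theorem riccatiC'_hasDerivAt {x : ℝ} (hx : x ≠ 0) (n : ℕ) :
    HasDerivAt (riccatiC' n) ((n * (n + 1) / x ^ 2 - 1) * riccatiC n x) x :=
  riccatiBesselDeriv_hasDerivAt Real.hasDerivAt_cos
    (fun x => by simpa using (Real.hasDerivAt_sin x).fun_neg) hx n

theorem riccatiK_hasDerivAt {x : ℝ} (hx : x ≠ 0) (n : ℕ) :
    HasDerivAt (riccatiK n) (riccatiK' n x) x :=
  riccatiBessel_hasDerivAt hasDerivAt_exp_neg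
    (fun x => by simpa using (hasDerivAt_exp_neg x).fun_neg) hx n

theorem riccatiK'_hasDerivAt {x : ℝ} (hx : x ≠ 0) (n : ℕ) :
    HasDerivAt (riccatiK' n) ((n * (n + 1) / x ^ 2 + 1) * riccatiK n x) x := by
  rw [← sub_neg_eq_add]
  exact riccatiBesselDeriv_hasDerivAt hasDerivAt_exp_neg
    (fun x => by simpa using (hasDerivAt_exp_neg x).fun_neg) hx n

theorem riccatiK'_eq (n : ℕ) (x : ℝ) :
    riccatiK' n x = (n + 1) / x * riccatiK n x - riccatiK (n + 1) x := rfl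

theorem riccatiK_zero (x : ℝ) : riccatiK 0 x = Real.exp (-x) := rfl

theorem riccatiK_one (x : ℝ) : riccatiK 1 x = Real.exp (-x) / x + Real.exp (-x) := by
  simp [riccatiK, riccatiBessel]

theorem riccatiK_add_two (n : ℕ) (x : ℝ) :
    riccatiK (n + 2) x = (2 * n + 3) / x * riccatiK (n + 1) x + riccatiK n x := by
  simp [riccatiK, riccatiBessel]

theorem riccatiI_hasDerivAt {x : ℝ} (hx : x ≠ 0) (n : ℕ) :
    HasDerivAt (riccatiI n) (riccatiI' n x) x :=
  riccatiBessel_hasDerivAt Real.hasDerivAt_exp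
    (fun x => by simpa using Real.hasDerivAt_exp x) hx n

theorem riccatiI'_hasDerivAt {x : ℝ} (hx : x ≠ 0) (n : ℕ) :
    HasDerivAt (riccatiI' n) ((n * (n + 1) / x ^ 2 + 1) * riccatiI n x) x := by
  rw [← sub_neg_eq_add]
  exact riccatiBesselDeriv_hasDerivAt Real.hasDerivAt_exp
    (fun x => by simpa using Real.hasDerivAt_exp x) hx n

theorem riccatiS_wronskian (x : ℝ) (n : ℕ) :
    riccatiS n x * riccatiC' n x - riccatiS' n x * riccatiC n x = -1 := by
  refine (riccatiBessel_wronskian 1 _ _ _ _ x n).trans ?_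
  have := Real.sin_sq_add_cos_sq x
  rw [one_pow]
  linarith

theorem riccatiK_wronskian (x : ℝ) (n : ℕ) :
    riccatiK n x * riccatiI' n x - riccatiK' n x * riccatiI n x = 2 * (-1) ^ n := by
  refine (riccatiBessel_wronskian (-1) _ _ _ _ x n).trans ?_
  have : Real.exp (-x) * Real.exp x = 1 := by rw [← Real.exp_add]; simp
  linear_combination (2 * (-1) ^ n) * this

/-! ### Behaviour of the Riccati-Bessel functions at the origin and at infinity. -/

/-- A function with nonnegative derivative and limit `0` at the origin is nonnegative. -/
theorem nonneg_of_hasDerivAt_nonneg_of_tendsto {f f' : ℝ → ℝ} {b : ℝ}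
    (hf : ∀ x, 0 < x → x ≤ b → HasDerivAt f (f' x) x) (hf' : ∀ x, 0 < x → x ≤ b → 0 ≤ f' x)
    (h0 : Tendsto f (𝓝[>] 0) (𝓝 0)) {x : ℝ} (hx : 0 < x) (hxb : x ≤ b) : 0 ≤ f x := by
  have hmono : MonotoneOn f (Ioc 0 b) := by
    apply monotoneOn_of_deriv_nonneg (convex_Ioc 0 b)
    · exact fun y hy => (hf y hy.1 hy.2).continuousAt.continuousWithinAt
    · intro y hy
      rw [interior_Ioc] at hy
      exact (hf y hy.1 hy.2.le).differentiableAt.differentiableWithinAt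
    · intro y hy
      rw [interior_Ioc] at hy
      rw [(hf y hy.1 hy.2.le).deriv]
      exact hf' y hy.1 hy.2.le
  refine le_of_tendsto h0 ?_
  filter_upwards [Ioo_mem_nhdsGT hx] with y hy
  exact hmono ⟨hy.1, hy.2.le.trans hxb⟩ ⟨hx, hxb⟩ hy.2.le

theorem tendsto_pow_mul_of_le {f : ℝ → ℝ} {m : ℕ}
    (h : ∀ x, 0 < x → x ≤ 1 → 0 ≤ f x ∧ f x ≤ x ^ (m + 1)) (k : ℕ) :
    Tendsto (fun x => x ^ k * f x) (𝓝[>] 0) (𝓝 0) := by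
  have h1 : Tendsto (fun x : ℝ => x) (𝓝[>] 0) (𝓝 0) := tendsto_nhdsWithin_of_tendsto_nhds tendsto_id
  refine tendsto_of_tendsto_of_tendsto_of_le_of_le' tendsto_const_nhds h1 ?_ ?_
  · filter_upwards [Ioo_mem_nhdsGT one_pos] with x hx
    exact mul_nonneg (pow_nonneg hx.1.le _) (h x hx.1 hx.2.le).1
  · filter_upwards [Ioo_mem_nhdsGT one_pos] with x hx
    have h2 : x ^ k ≤ 1 := pow_le_one₀ hx.1.le hx.2.le
    have h3 : x ^ (m + 1) ≤ x := by
      rw [pow_succ]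
      exact mul_le_of_le_one_left hx.1.le (pow_le_one₀ hx.1.le hx.2.le)
    have h4 := h x hx.1 hx.2.le
    calc x ^ k * f x ≤ 1 * x := mul_le_mul h2 (h4.2.trans h3) h4.1 zero_le_one
      _ = x := one_mul x

/-- Bounds on $S_n$ near the origin can thus be integrated to bounds on $S_{n+1}$. -/
theorem hasDerivAt_pow_mul_riccatiS {x : ℝ} (hx : x ≠ 0) (n : ℕ) :
    HasDerivAt (fun x => x ^ (n + 1) * riccatiS (n + 1) x) (x ^ (n + 1) * riccatiS n x) x := by
  refine ((hasDerivAt_pow (n + 1) x).fun_mul (riccatiS_succ_hasDerivAt hx n)).congr_deriv ?_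
  rw [Nat.add_sub_cancel]
  push_cast
  field_simp
  ring

/-- Integrate $c\,t^{2n+2} \le t^{n+1}S_n \le t^{2n+2}$ from the origin, where `h0` fixes the
constant of integration, and divide by $x^{n+1}$. The upper factor $1/(2n+3)$ is relaxed to $1$ so
that the form of the bound is preserved. -/
theorem riccatiS_bounds_succ {n : ℕ} {c : ℝ}
    (h : ∀ x, 0 < x → x ≤ 1 → c * x ^ (n + 1) ≤ riccatiS n x ∧ riccatiS n x ≤ x ^ (n + 1))
    (h0 : Tendsto (fun x => x ^ (n + 1) * riccatiS (n + 1) x) (𝓝[>] 0) (𝓝 0))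
    {x : ℝ} (hx : 0 < x) (hx1 : x ≤ 1) :
    c / (2 * n + 3) * x ^ (n + 2) ≤ riccatiS (n + 1) x ∧ riccatiS (n + 1) x ≤ x ^ (n + 2) := by
  have hp (a : ℝ) : Tendsto (fun x : ℝ => a / (2 * n + 3) * x ^ (2 * n + 3)) (𝓝[>] 0) (𝓝 0) := by
    have : Continuous (fun x : ℝ => a / (2 * n + 3) * x ^ (2 * n + 3)) := by fun_prop
    simpa using tendsto_nhdsWithin_of_tendsto_nhds (this.tendsto 0)
  have hd (a x : ℝ) : HasDerivAt (fun x : ℝ => a / (2 * n + 3) * x ^ (2 * n + 3))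
      (a * x ^ (2 * n + 2)) x := by
    refine ((hasDerivAt_pow (2 * n + 3) x).const_mul (a / (2 * n + 3))).congr_deriv ?_
    have : (2 * (n : ℝ) + 3) ≠ 0 := by positivity
    rw [show 2 * n + 3 - 1 = 2 * n + 2 by omega]
    push_cast
    field_simp
  have e (x : ℝ) : x ^ (2 * n + 2) = x ^ (n + 1) * x ^ (n + 1) := by ring
  have e' (x : ℝ) : x ^ (2 * n + 3) = x ^ (n + 1) * x ^ (n + 2) := by ring
  have hpos : 0 < x ^ (n + 1) := pow_pos hx _
  constructor
  · have := nonneg_of_hasDerivAt_nonneg_of_tendsto (b := 1)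
      (fun x hx _ => (hasDerivAt_pow_mul_riccatiS hx.ne' n).fun_sub (hd c x))
      (fun x hx hx1 => by
        rw [e]
        have := mul_le_mul_of_nonneg_left (h x hx hx1).1 (pow_pos hx (n + 1)).le
        linarith)
      (by simpa using h0.sub (hp c)) hx hx1
    simp only [e'] at this
    refine le_of_mul_le_mul_left ?_ hpos
    linarith
  · have := nonneg_of_hasDerivAt_nonneg_of_tendsto (b := 1)
      (fun x hx _ => (hd 1 x).fun_sub (hasDerivAt_pow_mul_riccatiS hx.ne' n))
      (fun x hx hx1 => by
        rw [e]
        have := mul_le_mul_of_nonneg_left (h x hx hx1).2 (pow_pos hx (n + 1)).le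
        linarith)
      (by simpa using (hp 1).sub h0) hx hx1
    simp only [e'] at this
    have h3 : 1 / (2 * (n : ℝ) + 3) ≤ 1 := by
      rw [div_le_one (by positivity)]
      linarith [(Nat.cast_nonneg n : (0 : ℝ) ≤ n)]
    have h4 := mul_le_mul_of_nonneg_right h3 (mul_pos hpos (pow_pos hx (n + 2))).le
    refine le_of_mul_le_mul_left ?_ hpos
    linarith

/-- The limit travels with the bounds: it is needed to integrate them to the next index, and the
recurrence multiplied by $x^{n+2}$ then returns the next limit. -/
theorem riccatiS_bounds_pair (n : ℕ) :
    (∃ c, 0 < c ∧ ∀ x, 0 < x → x ≤ 1 →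
      c * x ^ (n + 1) ≤ riccatiS n x ∧ riccatiS n x ≤ x ^ (n + 1)) ∧
    Tendsto (fun x => x ^ (n + 1) * riccatiS (n + 1) x) (𝓝[>] 0) (𝓝 0) := by
  induction n with
  | zero =>
    -- The constant comes from Jordan's inequality $2x/\pi \le \sin x$.
    refine ⟨⟨2 / Real.pi, by positivity, fun x hx hx1 => ?_⟩, ?_⟩
    · rw [riccatiS_zero, zero_add, pow_one]
      exact ⟨Real.mul_le_sin hx.le (hx1.trans (by linarith [Real.pi_gt_three])),
        Real.sin_le hx.le⟩
    · have : Continuous (fun x : ℝ => Real.sin x - x * Real.cos x) := by fun_prop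
      have h := tendsto_nhdsWithin_of_tendsto_nhds (s := Ioi 0) (this.tendsto 0)
      simp only [Real.sin_zero, zero_mul, sub_zero] at h
      refine h.congr' ?_
      filter_upwards [self_mem_nhdsWithin] with x hx
      have : x ≠ 0 := (mem_Ioi.mp hx).ne'
      rw [zero_add, riccatiS_one]
      field_simp
  | succ n ih =>
    obtain ⟨⟨c, hc, h⟩, h0⟩ := ih
    have hs := fun x hx hx1 => riccatiS_bounds_succ (x := x) h h0 hx hx1
    refine ⟨⟨c / (2 * n + 3), by positivity, hs⟩, ?_⟩
    have t1 := tendsto_pow_mul_of_le (f := riccatiS (n + 1)) (m := n + 1)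
      (fun x hx hx1 => ⟨le_trans (by positivity) (hs x hx hx1).1, (hs x hx hx1).2⟩) (n + 1)
    have t2 := tendsto_pow_mul_of_le (f := riccatiS n) (m := n)
      (fun x hx hx1 => ⟨le_trans (by positivity) (h x hx hx1).1, (h x hx hx1).2⟩) (n + 2)
    have := (t1.const_mul (2 * (n : ℝ) + 3)).sub t2
    simp only [mul_zero, sub_zero] at this
    refine this.congr' ?_
    filter_upwards [self_mem_nhdsWithin] with x hx
    have : x ≠ 0 := (mem_Ioi.mp hx).ne'
    rw [riccatiS_add_two]
    field_simp
    ring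

theorem riccatiS_bounds (n : ℕ) : ∃ c, 0 < c ∧ ∀ x, 0 < x → x ≤ 1 →
    c * x ^ (n + 1) ≤ riccatiS n x ∧ riccatiS n x ≤ x ^ (n + 1) :=
  (riccatiS_bounds_pair n).1

theorem riccatiS_pos (n : ℕ) {x : ℝ} (hx : 0 < x) (hx1 : x ≤ 1) : 0 < riccatiS n x := by
  obtain ⟨c, hc, h⟩ := riccatiS_bounds n
  exact lt_of_lt_of_le (by positivity) (h x hx hx1).1

theorem riccatiS_tendsto_zero (n : ℕ) : Tendsto (riccatiS n) (𝓝[>] 0) (𝓝 0) := by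
  obtain ⟨c, hc, h⟩ := riccatiS_bounds n
  simpa using tendsto_pow_mul_of_le (f := riccatiS n) (m := n)
      (fun x hx hx1 => ⟨(riccatiS_pos n hx hx1).le, (h x hx hx1).2⟩) 0

/-- After multiplication by $x^{n+2}$ the term of index $n$ in the recurrence carries an extra $x^2$
and drops out, so the limit is just multiplied by $2n+3$. -/
theorem riccatiC_tendsto_pair (n : ℕ) : ∃ a b : ℝ, 0 < a ∧ 0 < b ∧
    Tendsto (fun x => x ^ n * riccatiC n x) (𝓝[>] 0) (𝓝 a) ∧
    Tendsto (fun x => x ^ (n + 1) * riccatiC (n + 1) x) (𝓝[>] 0) (𝓝 b) := by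
  induction n with
  | zero =>
    refine ⟨1, 1, one_pos, one_pos, ?_, ?_⟩
    · have : Continuous (fun x : ℝ => x ^ 0 * Real.cos x) := by fun_prop
      have h := tendsto_nhdsWithin_of_tendsto_nhds (s := Ioi 0) (this.tendsto 0)
      rwa [pow_zero, Real.cos_zero, mul_one] at h
    · have : Continuous (fun x : ℝ => Real.cos x + x * Real.sin x) := by fun_prop
      have h := tendsto_nhdsWithin_of_tendsto_nhds (s := Ioi 0) (this.tendsto 0)
      simp only [Real.cos_zero, zero_mul, add_zero] at h
      refine h.congr' ?_
      filter_upwards [self_mem_nhdsWithin] with x hx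
      have : x ≠ 0 := (mem_Ioi.mp hx).ne'
      simp only [riccatiC, riccatiBessel]
      field_simp
      ring
  | succ n ih =>
    obtain ⟨a, b, ha, hb, h1, h2⟩ := ih
    refine ⟨b, (2 * n + 3) * b, hb, by positivity, h2, ?_⟩
    have hx2 : Tendsto (fun x : ℝ => x ^ 2) (𝓝[>] 0) (𝓝 0) := by
      simpa using tendsto_nhdsWithin_of_tendsto_nhds (s := Ioi (0 : ℝ))
        ((continuous_pow 2).tendsto (0 : ℝ))
    have := (h2.const_mul (2 * (n : ℝ) + 3)).sub (hx2.mul h1)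
    simp only [zero_mul, sub_zero] at this
    refine this.congr' ?_
    filter_upwards [self_mem_nhdsWithin] with x hx
    have : x ≠ 0 := (mem_Ioi.mp hx).ne'
    simp only [riccatiC, riccatiBessel]
    field_simp
    ring

theorem riccatiC_not_tendsto_zero (n : ℕ) : ¬ Tendsto (riccatiC n) (𝓝[>] 0) (𝓝 0) := by
  intro h
  obtain ⟨a, -, ha, -, h1, -⟩ := riccatiC_tendsto_pair n
  have hp : Tendsto (fun x : ℝ => x ^ n) (𝓝[>] 0) (𝓝 (0 ^ n)) :=
    tendsto_nhdsWithin_of_tendsto_nhds ((continuous_pow n).tendsto (0 : ℝ))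
  have h2 := hp.mul h
  rw [mul_zero] at h2
  exact ha.ne' (tendsto_nhds_unique h1 h2)

theorem riccatiK_pos (n : ℕ) {x : ℝ} (hx : 0 < x) : 0 < riccatiK n x := by
  have : 0 < riccatiK n x ∧ 0 < riccatiK (n + 1) x := by
    induction n with
    | zero =>
      rw [riccatiK_zero, zero_add, riccatiK_one]
      exact ⟨by positivity, by positivity⟩
    | succ n ih =>
      refine ⟨ih.2, ?_⟩
      rw [riccatiK_add_two]
      have := ih.1
      have := ih.2
      positivity
  exact this.1

theorem riccatiK_le (n : ℕ) {a : ℝ} (ha : 0 < a) :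
    ∃ B, ∀ x, a ≤ x → riccatiK n x ≤ B * Real.exp (-x) := by
  have : (∃ B, ∀ x, a ≤ x → riccatiK n x ≤ B * Real.exp (-x)) ∧
      (∃ B, ∀ x, a ≤ x → riccatiK (n + 1) x ≤ B * Real.exp (-x)) := by
    induction n with
    | zero =>
      refine ⟨⟨1, fun x _ => by simp [riccatiK_zero]⟩, ⟨1 / a + 1, fun x hx => ?_⟩⟩
      rw [zero_add, riccatiK_one]
      have : Real.exp (-x) / x ≤ Real.exp (-x) / a := by gcongr
      linarith [one_div_mul_eq_div a (Real.exp (-x))]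
    | succ n ih =>
      refine ⟨ih.2, ?_⟩
      obtain ⟨⟨B, hB⟩, ⟨B', hB'⟩⟩ := ih
      refine ⟨(2 * n + 3) / a * B' + B, fun x hx => ?_⟩
      have hx0 : 0 < x := ha.trans_le hx
      rw [riccatiK_add_two, add_mul, mul_assoc]
      refine add_le_add ?_ (hB x hx)
      refine mul_le_mul ?_ (hB' x hx) (riccatiK_pos _ hx0).le (by positivity)
      gcongr
  exact this.1

/-- The coefficient $(2n+3)/x$ vanishes at infinity and $\kappa=-1$, so the limit for $n+2$ is the
one for $n$. The limits alternate between $1$ and $-1$ and are never zero. -/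
theorem riccatiI_tendsto (n : ℕ) : ∃ c : ℝ, c ≠ 0 ∧
    Tendsto (fun x => Real.exp (-x) * riccatiI n x) atTop (𝓝 c) := by
  have e (x : ℝ) : Real.exp (-x) * Real.exp x = 1 := by rw [← Real.exp_add]; simp
  have : ∃ c d : ℝ, c ≠ 0 ∧ d ≠ 0 ∧
      Tendsto (fun x => Real.exp (-x) * riccatiI n x) atTop (𝓝 c) ∧
      Tendsto (fun x => Real.exp (-x) * riccatiI (n + 1) x) atTop (𝓝 d) := by
    induction n with
    | zero =>
      refine ⟨1, -1, by norm_num, by norm_num, ?_, ?_⟩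
      · simp only [riccatiI, riccatiBessel, e]
        exact tendsto_const_nhds
      · have : Tendsto (fun x : ℝ => x⁻¹ - 1) atTop (𝓝 (0 - 1)) :=
          tendsto_inv_atTop_zero.sub_const 1
        rw [zero_sub] at this
        refine this.congr fun x => ?_
        simp only [riccatiI, riccatiBessel]
        linear_combination (1 - x⁻¹) * e x
    | succ n ih =>
      obtain ⟨c, d, hc, hd, h1, h2⟩ := ih
      refine ⟨d, c, hd, hc, h2, ?_⟩
      have := ((tendsto_inv_atTop_zero.const_mul (2 * (n : ℝ) + 3)).mul h2).add h1
      simp only [mul_zero, zero_mul, zero_add] at this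
      refine this.congr fun x => ?_
      simp only [riccatiI, riccatiBessel]
      ring
  obtain ⟨c, d, hc, -, h, -⟩ := this
  exact ⟨c, hc, h⟩

theorem riccatiI_tendsto_abs (n : ℕ) : Tendsto (fun x => |riccatiI n x|) atTop atTop := by
  obtain ⟨c, hc, h⟩ := riccatiI_tendsto n
  have := Real.tendsto_exp_atTop.atTop_mul_pos (abs_pos.mpr hc) h.abs
  refine this.congr fun x => ?_
  rw [abs_mul, Real.abs_exp, ← mul_assoc, ← Real.exp_add]
  simp

end RiccatiBessel

/-! ### Bessel functions of the first kind of half-integer order. -/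

section BesselJ

/-- The coefficients of the power series of the Bessel function of the first kind. -/
noncomputable def besselJCoeff (ν : ℝ) (k : ℕ) : ℝ :=
  (-1 : ℝ) ^ k / ((k.factorial : ℝ) * Real.Gamma (ν + k + 1))

/-- Coefficient form of $\frac{2\nu}{x}J_\nu = J_{\nu-1}+J_{\nu+1}$. The index of the last term is
shifted because $J_{\nu+1}$ carries an extra factor $(x/2)^2$ relative to $J_{\nu-1}$. -/
theorem besselJCoeff_succ {ν : ℝ} (hν : 0 < ν) (k : ℕ) :
    ν * besselJCoeff ν (k + 1) = besselJCoeff (ν - 1) (k + 1) + besselJCoeff (ν + 1) k := by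
  have hk : 0 < ν + k + 1 := by positivity
  have g1 : Real.Gamma (ν + (k + 1 : ℕ) + 1) = (ν + k + 1) * Real.Gamma (ν + k + 1) := by
    rw [← Real.Gamma_add_one hk.ne']
    push_cast
    ring_nf
  have g2 : Real.Gamma (ν - 1 + (k + 1 : ℕ) + 1) = Real.Gamma (ν + k + 1) := by
    push_cast
    ring_nf
  have g3 : Real.Gamma (ν + 1 + k + 1) = (ν + k + 1) * Real.Gamma (ν + k + 1) := by
    rw [← Real.Gamma_add_one hk.ne']
    ring_nf
  have hG := (Real.Gamma_pos_of_pos hk).ne'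
  simp only [besselJCoeff, g1, g2, g3, Nat.factorial_succ]
  have := Nat.factorial_ne_zero k
  push_cast
  field_simp
  ring

theorem besselJCoeff_zero {ν : ℝ} (hν : 0 < ν) :
    ν * besselJCoeff ν 0 = besselJCoeff (ν - 1) 0 := by
  have g1 := Real.Gamma_add_one hν.ne'
  have hG := (Real.Gamma_pos_of_pos hν).ne'
  simp [besselJCoeff, g1]
  field_simp

theorem besselJ_eq (ν x : ℝ) :
    besselJ ν x = (x / 2) ^ ν * ∑' k : ℕ, besselJCoeff ν k * (x / 2) ^ (2 * k) := rfl

/-- Convergence climbs in the order through the coefficient recurrence, so the sine and cosine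
series are the only ones whose convergence is used directly. -/
theorem besselJ_summable_of_pred {ν : ℝ} (hν : 0 < ν) {y : ℝ}
    (h0 : Summable fun k : ℕ => besselJCoeff (ν - 1) k * y ^ (2 * k))
    (h1 : Summable fun k : ℕ => besselJCoeff ν k * y ^ (2 * k)) (hy : y ≠ 0) :
    Summable fun k : ℕ => besselJCoeff (ν + 1) k * y ^ (2 * k) := by
  have h0' := (summable_nat_add_iff 1).2 h0
  have h1' := (summable_nat_add_iff 1).2 h1
  have := ((h1'.mul_left ν).sub h0').mul_left (y ^ 2)⁻¹
  refine this.congr fun k => ?_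
  rw [← mul_assoc ν, besselJCoeff_succ hν]
  have : y ^ (2 * (k + 1)) = y ^ 2 * y ^ (2 * k) := by ring
  rw [this]
  field_simp
  ring

theorem besselJ_recurrence {ν : ℝ} (hν : 0 < ν) {x : ℝ} (hx : 0 < x)
    (h0 : Summable fun k : ℕ => besselJCoeff (ν - 1) k * (x / 2) ^ (2 * k))
    (h1 : Summable fun k : ℕ => besselJCoeff ν k * (x / 2) ^ (2 * k)) :
    besselJ (ν + 1) x = 2 * ν / x * besselJ ν x - besselJ (ν - 1) x := by
  have hy : 0 < x / 2 := by positivity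
  have h2 := besselJ_summable_of_pred hν h0 h1 hy.ne'
  simp only [besselJ_eq]
  have e : ν * ∑' k : ℕ, besselJCoeff ν k * (x / 2) ^ (2 * k) =
      (∑' k : ℕ, besselJCoeff (ν - 1) k * (x / 2) ^ (2 * k)) +
        (x / 2) ^ 2 * ∑' k : ℕ, besselJCoeff (ν + 1) k * (x / 2) ^ (2 * k) := by
    rw [h1.tsum_eq_zero_add, h0.tsum_eq_zero_add, mul_add, ← tsum_mul_left, ← tsum_mul_left,
      add_assoc, ← ((summable_nat_add_iff 1).2 h0).tsum_add (h2.mul_left _)]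
    congr 1
    · rw [← mul_assoc, besselJCoeff_zero hν]
    · refine tsum_congr fun k => ?_
      rw [← mul_assoc ν, besselJCoeff_succ hν]
      ring
  have p1 : (x / 2) ^ (ν + 1) = (x / 2) ^ (ν - 1) * (x / 2) ^ 2 := by
    rw [← Real.rpow_add_natCast hy.ne']
    norm_num
    ring_nf
  have p2 : (x / 2) ^ ν = (x / 2) ^ (ν - 1) * (x / 2) := by
    rw [← Real.rpow_add_one hy.ne']
    norm_num
  rw [p1, p2]
  set a := (x / 2) ^ (ν - 1)
  set S0 := ∑' k : ℕ, besselJCoeff (ν - 1) k * (x / 2) ^ (2 * k)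
  set S1 := ∑' k : ℕ, besselJCoeff ν k * (x / 2) ^ (2 * k)
  set S2 := ∑' k : ℕ, besselJCoeff (ν + 1) k * (x / 2) ^ (2 * k)
  have e' : 2 * ν / x * (a * (x / 2) * S1) = a * (ν * S1) := by field_simp
  rw [e', e]
  ring

/-- Legendre's duplication formula at $k+1$ turns $k!\,\Gamma(k+\tfrac32)$ into a multiple of
$(2k+1)!$, which produces the sine series. -/
theorem besselJCoeff_half (k : ℕ) :
    besselJCoeff (1 / 2) k =
      (-1) ^ k / (2 * k + 1).factorial * 2 ^ (2 * k) * (2 / √Real.pi) := by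
  have h := Real.Gamma_mul_Gamma_add_half (k + 1)
  rw [Real.Gamma_nat_eq_factorial] at h
  have h2 : Real.Gamma (2 * ((k : ℝ) + 1)) = (2 * k + 1).factorial := by
    rw [← Real.Gamma_nat_eq_factorial]
    push_cast
    ring_nf
  have h3 : (2 : ℝ) ^ (1 - 2 * ((k : ℝ) + 1)) = (2 ^ (2 * k) * 2)⁻¹ := by
    rw [← pow_succ, ← Real.rpow_natCast, ← Real.rpow_neg zero_le_two]
    push_cast
    ring_nf
  rw [h2, h3, show (k : ℝ) + 1 + 1 / 2 = 1 / 2 + k + 1 by ring] at h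
  rw [besselJCoeff, h]
  have := Nat.factorial_ne_zero (2 * k + 1)
  have : √Real.pi ≠ 0 := (Real.sqrt_pos.2 Real.pi_pos).ne'
  field_simp

theorem besselJCoeff_neg_half (k : ℕ) :
    besselJCoeff (-1 / 2) k = (-1) ^ k / (2 * k).factorial * 2 ^ (2 * k) / √Real.pi := by
  have h := besselJCoeff_half k
  have hk : (0 : ℝ) < k + 1 / 2 := by positivity
  have g := Real.Gamma_add_one hk.ne'
  have hG := (Real.Gamma_pos_of_pos hk).ne'
  rw [besselJCoeff, show (1 : ℝ) / 2 + k + 1 = k + 1 / 2 + 1 by ring, g, Nat.factorial_succ] at h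
  rw [besselJCoeff, show (-1 : ℝ) / 2 + k + 1 = k + 1 / 2 by ring]
  have e : (-1 : ℝ) ^ k / (k.factorial * Real.Gamma (k + 1 / 2)) =
      (k + 1 / 2) * ((-1) ^ k / (k.factorial * ((k + 1 / 2) * Real.Gamma (k + 1 / 2)))) := by
    have := Nat.factorial_ne_zero k
    field_simp
  rw [e, h]
  have := Nat.factorial_ne_zero (2 * k)
  have : √Real.pi ≠ 0 := (Real.sqrt_pos.2 Real.pi_pos).ne'
  push_cast
  field_simp

theorem hasSum_besselJCoeff_half {x : ℝ} (hx : x ≠ 0) :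
    HasSum (fun k : ℕ => besselJCoeff (1 / 2) k * (x / 2) ^ (2 * k))
      (2 / √Real.pi * (Real.sin x / x)) := by
  have h := ((Real.hasSum_sin x).div_const x).mul_left (2 / √Real.pi)
  rw [funext fun k : ℕ => (?_ : besselJCoeff (1 / 2) k * (x / 2) ^ (2 * k) =
    2 / √Real.pi * ((-1) ^ k * x ^ (2 * k + 1) / (2 * k + 1).factorial / x))]
  · exact h
  rw [besselJCoeff_half, div_pow, pow_succ]
  field_simp

theorem hasSum_besselJCoeff_neg_half (x : ℝ) :
    HasSum (fun k : ℕ => besselJCoeff (-1 / 2) k * (x / 2) ^ (2 * k))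
      (1 / √Real.pi * Real.cos x) := by
  have h := (Real.hasSum_cos x).mul_left (1 / √Real.pi)
  rw [funext fun k : ℕ => (?_ : besselJCoeff (-1 / 2) k * (x / 2) ^ (2 * k) =
    1 / √Real.pi * ((-1) ^ k * x ^ (2 * k) / (2 * k).factorial))]
  · exact h
  rw [besselJCoeff_neg_half, div_pow]
  field_simp

/-- Both sides obey the same recurrence in $n$, and it starts from $J_{1/2}\propto\sin$ and
$J_{-1/2}\propto\cos$. The factor does not depend on $n$, so it cancels in quotients. -/
theorem besselJ_half_pair {x : ℝ} (hx : 0 < x) (n : ℕ) :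
    ((Summable fun k : ℕ => besselJCoeff (n - 1 / 2) k * (x / 2) ^ (2 * k)) ∧
      Summable fun k : ℕ => besselJCoeff (n + 1 / 2) k * (x / 2) ^ (2 * k)) ∧
    besselJ (n + 1 / 2) x = (x / 2) ^ (1 / 2 : ℝ) * (2 / √Real.pi) / x * riccatiS n x ∧
    besselJ (n + 3 / 2) x = (x / 2) ^ (1 / 2 : ℝ) * (2 / √Real.pi) / x * riccatiS (n + 1) x := by
  induction n with
  | zero =>
    have h1 := hasSum_besselJCoeff_half hx.ne'
    have h0 := hasSum_besselJCoeff_neg_half x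
    have e1 : besselJ (1 / 2) x = (x / 2) ^ (1 / 2 : ℝ) * (2 / √Real.pi) / x * Real.sin x := by
      rw [besselJ_eq, h1.tsum_eq]
      ring
    have e0 : besselJ (-1 / 2) x = (x / 2) ^ (1 / 2 : ℝ) * (2 / √Real.pi) / x * Real.cos x := by
      have hy : 0 < x / 2 := by positivity
      rw [besselJ_eq, h0.tsum_eq, show (-1 / 2 : ℝ) = 1 / 2 - 1 by norm_num,
        Real.rpow_sub_one hy.ne']
      field_simp
    have e : (1 / 2 : ℝ) - 1 = -1 / 2 := by norm_num
    have h := besselJ_recurrence (ν := 1 / 2) (by norm_num) hx (by rw [e]; exact h0.summable)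
      h1.summable
    rw [e, e1, e0] at h
    refine ⟨⟨?_, ?_⟩, ?_, ?_⟩
    · simpa [neg_div] using h0.summable
    · simpa using h1.summable
    · simpa [riccatiS_zero] using e1
    · rw [show ((0 : ℕ) : ℝ) + 3 / 2 = 1 / 2 + 1 by norm_num, h, zero_add, riccatiS_one]
      ring
  | succ n ih =>
    obtain ⟨⟨s0, s1⟩, e0, e1⟩ := ih
    have hn : (0 : ℝ) < n + 1 / 2 := by positivity
    have hn' : (0 : ℝ) < n + 3 / 2 := by positivity
    have c1 : ((n + 1 : ℕ) : ℝ) - 1 / 2 = n + 1 / 2 := by push_cast; ring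
    have c2 : ((n + 1 : ℕ) : ℝ) + 1 / 2 = n + 1 / 2 + 1 := by push_cast; ring
    have c3 : ((n + 1 : ℕ) : ℝ) + 3 / 2 = n + 3 / 2 + 1 := by push_cast; ring
    have c4 : (n : ℝ) + 3 / 2 - 1 = n + 1 / 2 := by ring
    have c5 : (n : ℝ) + 1 / 2 + 1 = n + 3 / 2 := by ring
    have s2 := besselJ_summable_of_pred hn (by convert s0 using 4; ring) s1
      (show x / 2 ≠ 0 by positivity)
    have h := besselJ_recurrence hn' hx (by rw [c4]; exact s1) (by rw [← c5]; exact s2)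
    rw [c1, c2, c3]
    refine ⟨⟨s1, s2⟩, by rw [c5]; exact e1, ?_⟩
    rw [h, c4, e0, e1, riccatiS_add_two]
    ring

/-- The factor that relates Bessel and Riccati-Bessel functions is positive. -/
theorem besselJ_half_factor_pos {x : ℝ} (hx : 0 < x) :
    0 < (x / 2) ^ (1 / 2 : ℝ) * (2 / √Real.pi) / x := by
  have := Real.pi_pos
  positivity

theorem besselJ_half_eq_zero_iff {x : ℝ} (hx : 0 < x) (n : ℕ) :
    besselJ (n + 1 / 2) x = 0 ↔ riccatiS n x = 0 := by
  rw [(besselJ_half_pair hx n).2.1, mul_eq_zero, or_iff_right (besselJ_half_factor_pos hx).ne']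

theorem secularLHS_eq {x : ℝ} (hx : 0 < x) (n : ℕ) :
    secularLHS n x = x * riccatiS (n + 1) x / riccatiS n x := by
  rw [secularLHS, (besselJ_half_pair hx n).2.2, (besselJ_half_pair hx n).2.1, mul_left_comm,
    mul_div_mul_left _ _ (besselJ_half_factor_pos hx).ne']

end BesselJ

/-! ### Modified Bessel functions: recurrence, quotients and their monotonicity. -/

section BesselK

/-- Use $\cosh t\ge t^2/4$ and complete the square. The bound by a multiple of $e^{-t}$ serves both
integrability and the vanishing of the boundary term at infinity. -/
theorem exp_cosh_mul_exp_le {x : ℝ} (hx : 0 < x) (a : ℝ) {t : ℝ} (ht : 0 ≤ t) :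
    Real.exp (-x * Real.cosh t) * Real.exp (a * t) ≤
      Real.exp ((a + 1) ^ 2 / x) * Real.exp (-1 * t) := by
  rw [← Real.exp_add, ← Real.exp_add, Real.exp_le_exp]
  have h1 : t ^ 2 / 4 ≤ Real.cosh t := by
    have := Real.quadratic_le_exp_of_nonneg ht
    have := Real.exp_pos (-t)
    rw [Real.cosh_eq]
    linarith
  have h2 := mul_le_mul_of_nonneg_left h1 hx.le
  have h3 : 0 ≤ x * (t / 2 - (a + 1) / x) ^ 2 := by positivity
  have h4 : x * (t / 2 - (a + 1) / x) ^ 2 = x * (t ^ 2 / 4) - (a + 1) * t + (a + 1) ^ 2 / x := by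
    field_simp
    ring
  linarith

theorem integrableOn_exp_cosh_mul_exp {x : ℝ} (hx : 0 < x) (a : ℝ) :
    IntegrableOn (fun t => Real.exp (-x * Real.cosh t) * Real.exp (a * t)) (Ioi 0) := by
  refine integrable_of_isBigO_exp_neg (b := 1) one_pos (by fun_prop) ?_
  refine Asymptotics.IsBigO.of_bound (Real.exp ((a + 1) ^ 2 / x)) ?_
  filter_upwards [eventually_ge_atTop 0] with t ht
  rw [Real.norm_of_nonneg (by positivity), Real.norm_of_nonneg (by positivity)]
  exact exp_cosh_mul_exp_le hx a ht

theorem tendsto_exp_cosh_mul_exp {x : ℝ} (hx : 0 < x) (a : ℝ) :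
    Tendsto (fun t => Real.exp (-x * Real.cosh t) * Real.exp (a * t)) atTop (𝓝 0) := by
  have h : Tendsto (fun t : ℝ => Real.exp ((a + 1) ^ 2 / x) * Real.exp (-1 * t)) atTop (𝓝 0) := by
    have := (Real.tendsto_exp_neg_atTop_nhds_zero).const_mul (Real.exp ((a + 1) ^ 2 / x))
    simpa using this
  refine tendsto_of_tendsto_of_tendsto_of_le_of_le' tendsto_const_nhds h ?_ ?_
  · exact Eventually.of_forall fun t => by positivity
  · filter_upwards [eventually_ge_atTop 0] with t ht using exp_cosh_mul_exp_le hx a ht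

theorem integrableOn_besselK {x : ℝ} (hx : 0 < x) (ν : ℝ) :
    IntegrableOn (fun t => Real.exp (-x * Real.cosh t) * Real.cosh (ν * t)) (Ioi 0) := by
  have h := ((integrableOn_exp_cosh_mul_exp hx ν).add
    (integrableOn_exp_cosh_mul_exp hx (-ν))).div_const 2
  refine h.congr (Eventually.of_forall fun t => ?_)
  simp only [Pi.add_apply, Real.cosh_eq, neg_mul]
  ring

theorem besselK_pos {x : ℝ} (hx : 0 < x) (ν : ℝ) : 0 < besselK ν x := by
  have h := integrableOn_besselK hx ν
  rw [besselK, setIntegral_pos_iff_support_of_nonneg_ae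
    (Eventually.of_forall fun t => by have := Real.cosh_pos (ν * t); positivity) h]
  have : Function.support (fun t => Real.exp (-x * Real.cosh t) * Real.cosh (ν * t)) = univ := by
    ext t
    have := Real.cosh_pos (ν * t)
    simp only [Function.mem_support, mem_univ, iff_true]
    positivity
  rw [this, univ_inter]
  simp

theorem besselK_neg (ν x : ℝ) : besselK (-ν) x = besselK ν x := by
  simp [besselK]

theorem tendsto_exp_cosh_mul_sinh {x : ℝ} (hx : 0 < x) (ν : ℝ) :
    Tendsto (fun t => Real.exp (-x * Real.cosh t) * Real.sinh (ν * t)) atTop (𝓝 0) := by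
  have := ((tendsto_exp_cosh_mul_exp hx ν).sub (tendsto_exp_cosh_mul_exp hx (-ν))).div_const 2
  rw [sub_zero, zero_div] at this
  refine this.congr fun t => ?_
  rw [Real.sinh_eq, neg_mul ν]
  ring

/-- Integrate the derivative of $e^{-x\cosh t}\sinh\nu t$ over the half-line. Both boundary terms
vanish, and $\sinh t\,\sinh\nu t$ is half a difference of hyperbolic cosines. -/
theorem besselK_recurrence {x : ℝ} (hx : 0 < x) (ν : ℝ) :
    besselK (ν + 1) x = 2 * ν / x * besselK ν x + besselK (ν - 1) x := by
  have i1 := integrableOn_besselK hx (ν + 1)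
  have i2 := integrableOn_besselK hx (ν - 1)
  have i3 := integrableOn_besselK hx ν
  have i4 : IntegrableOn (fun t => Real.exp (-x * Real.cosh t) * Real.cosh ((ν + 1) * t) -
      Real.exp (-x * Real.cosh t) * Real.cosh ((ν - 1) * t)) (Ioi 0) := i1.sub i2
  have hd (t : ℝ) : HasDerivAt (fun t => Real.exp (-x * Real.cosh t) * Real.sinh (ν * t))
      (ν * (Real.exp (-x * Real.cosh t) * Real.cosh (ν * t)) -
        x / 2 * (Real.exp (-x * Real.cosh t) * Real.cosh ((ν + 1) * t) -
          Real.exp (-x * Real.cosh t) * Real.cosh ((ν - 1) * t))) t := by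
    have := (((Real.hasDerivAt_cosh t).const_mul (-x)).exp).fun_mul
      (((hasDerivAt_id' t).const_mul ν).sinh)
    refine this.congr_deriv ?_
    rw [add_mul, sub_mul, one_mul, Real.cosh_add, Real.cosh_sub]
    ring
  have := integral_Ioi_of_hasDerivAt_of_tendsto' (a := 0) (fun t _ => hd t)
    ((i3.const_mul ν).sub (i4.const_mul (x / 2))) (tendsto_exp_cosh_mul_sinh hx ν)
  rw [integral_sub (i3.const_mul ν) (i4.const_mul (x / 2)), integral_const_mul,
    integral_const_mul, integral_sub i1 i2] at this
  simp only [mul_zero, Real.sinh_zero, sub_zero] at this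
  change ν * besselK ν x - x / 2 * (besselK (ν + 1) x - besselK (ν - 1) x) = 0 at this
  field_simp
  linarith

/-- The ratio `x K_{n + 3/2}(x) / K_{n + 1/2}(x)`. -/
noncomputable def besselKRatio (n : ℕ) (x : ℝ) : ℝ := x * riccatiK (n + 1) x / riccatiK n x

theorem besselKRatio_zero {x : ℝ} (hx : 0 < x) : besselKRatio 0 x = x + 1 := by
  rw [besselKRatio, riccatiK_zero, zero_add, riccatiK_one]
  field_simp
  ring

theorem besselKRatio_pos (n : ℕ) {x : ℝ} (hx : 0 < x) : 0 < besselKRatio n x :=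
  div_pos (mul_pos hx (riccatiK_pos _ hx)) (riccatiK_pos _ hx)

theorem besselKRatio_succ (n : ℕ) {x : ℝ} (hx : 0 < x) :
    besselKRatio (n + 1) x = 2 * n + 3 + x ^ 2 / besselKRatio n x := by
  have := (riccatiK_pos n hx).ne'
  have := (riccatiK_pos (n + 1) hx).ne'
  rw [besselKRatio, besselKRatio, riccatiK_add_two]
  field_simp

/-- The symmetry $K_{-1/2}=K_{1/2}$ starts the quotients and the recurrence continues them, so no
$K_\nu$ has to be evaluated. -/
theorem besselK_ratio_eq {x : ℝ} (hx : 0 < x) (n : ℕ) :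
    x * besselK (n + 3 / 2) x / besselK (n + 1 / 2) x = besselKRatio n x := by
  induction n with
  | zero =>
    have h := besselK_recurrence hx (1 / 2)
    have hn := besselK_neg (1 / 2) x
    have hp := besselK_pos hx (1 / 2)
    rw [show (1 / 2 : ℝ) - 1 = -(1 / 2) by norm_num, hn] at h
    rw [besselKRatio_zero hx, show ((0 : ℕ) : ℝ) + 3 / 2 = 1 / 2 + 1 by norm_num,
      show ((0 : ℕ) : ℝ) + 1 / 2 = 1 / 2 by norm_num, h]
    field_simp
    ring
  | succ n ih =>
    have h := besselK_recurrence hx (n + 3 / 2)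
    have hp := besselK_pos hx (n + 1 / 2)
    have hp' := besselK_pos hx (n + 3 / 2)
    rw [besselKRatio_succ n hx, ← ih,
      show ((n + 1 : ℕ) : ℝ) + 3 / 2 = n + 3 / 2 + 1 by push_cast; ring,
      show ((n + 1 : ℕ) : ℝ) + 1 / 2 = n + 3 / 2 by push_cast; ring, h,
      show (n : ℝ) + 3 / 2 - 1 = n + 1 / 2 by ring]
    generalize besselK (n + 1 / 2) x = a at *
    generalize besselK (n + 3 / 2) x = b at *
    field_simp

theorem secularRHS_eq (n : ℕ) (β w : ℝ) {x : ℝ} (hx : 0 < x) :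
    secularRHS n β w x = (2 + β) ^ 2 / (2 - β) ^ 2 * besselKRatio n x
      - 8 * β * (n + 1) / (2 - β) ^ 2 + w / (2 - β) ^ 2 := by
  rw [secularRHS, besselK_ratio_eq hx]

/-- With $\rho_{n+1} = 2n+3+x^2/\rho_n$, the second claim at $n$ is the first at $n+1$. The second
at $n+1$ follows from the first at $n$, since $x^2/\rho_{n+1} = ((2n+3)/x^2+1/\rho_n)^{-1}$. -/
theorem besselKRatio_strictMonoOn (n : ℕ) : StrictMonoOn (besselKRatio n) (Ioi 0) ∧
    StrictMonoOn (fun x => x ^ 2 / besselKRatio n x) (Ioi 0) := by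
  induction n with
  | zero =>
    refine ⟨fun x hx y hy hxy => ?_, fun x hx y hy hxy => ?_⟩
    · rw [besselKRatio_zero hx, besselKRatio_zero hy]
      linarith
    · have hx' : 0 < x := hx
      have hy' : 0 < y := hy
      simp only [besselKRatio_zero hx', besselKRatio_zero hy']
      rw [div_lt_div_iff₀ (by positivity) (by positivity)]
      -- This product is $y^2(x+1)-x^2(y+1)$.
      have : 0 < (y - x) * (x * y + x + y) := mul_pos (by linarith) (by positivity)
      nlinarith
  | succ n ih =>
    refine ⟨fun x hx y hy hxy => ?_, fun x hx y hy hxy => ?_⟩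
    · rw [besselKRatio_succ n hx, besselKRatio_succ n hy]
      linarith [ih.2 hx hy hxy]
    · have hx' : 0 < x := hx
      have hy' : 0 < y := hy
      have px := besselKRatio_pos n hx'
      have py := besselKRatio_pos n hy'
      have h := ih.1 hx hy hxy
      have e {z : ℝ} (hz : 0 < z) : z ^ 2 / besselKRatio (n + 1) z =
          ((2 * n + 3) / z ^ 2 + (besselKRatio n z)⁻¹)⁻¹ := by
        have := besselKRatio_pos n hz
        rw [besselKRatio_succ n hz]
        field_simp
      simp only [e hx', e hy']
      gcongr

theorem besselKRatio_tendsto (n : ℕ) :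
    Tendsto (besselKRatio n) (𝓝[>] 0) (𝓝 (2 * n + 1)) := by
  have hx2 : Tendsto (fun x : ℝ => x ^ 2) (𝓝[>] 0) (𝓝 0) := by
    simpa using tendsto_nhdsWithin_of_tendsto_nhds (s := Ioi (0 : ℝ))
      ((continuous_pow 2).tendsto (0 : ℝ))
  induction n with
  | zero =>
    have : Continuous (fun x : ℝ => x + 1) := by fun_prop
    have h := tendsto_nhdsWithin_of_tendsto_nhds (s := Ioi 0) (this.tendsto 0)
    simp only [Nat.cast_zero, mul_zero]
    refine h.congr' ?_
    filter_upwards [self_mem_nhdsWithin] with x hx using (besselKRatio_zero hx).symm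
  | succ n ih =>
    have := (hx2.div ih (by positivity)).const_add (2 * (n : ℝ) + 3)
    rw [zero_div, add_zero] at this
    rw [show 2 * ((n + 1 : ℕ) : ℝ) + 1 = 2 * n + 3 by push_cast; ring]
    refine this.congr' ?_
    filter_upwards [self_mem_nhdsWithin] with x hx using (besselKRatio_succ n hx).symm

theorem besselKRatio_continuousOn (n : ℕ) : ContinuousOn (besselKRatio n) (Ioi 0) := by
  intro x hx
  have hx' : x ≠ 0 := (mem_Ioi.mp hx).ne'
  refine ContinuousAt.continuousWithinAt ?_
  exact (continuousAt_id.mul (riccatiK_hasDerivAt hx' (n + 1)).continuousAt).div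
    (riccatiK_hasDerivAt hx' n).continuousAt (riccatiK_pos n hx).ne'

end BesselK

/-! ### Strict comparison of a monotone function with its one-sided limits. -/

section Monotone

theorem lt_of_strictMonoOn_of_tendsto {f : ℝ → ℝ} {a b l : ℝ} (hf : StrictMonoOn f (Ioo a b))
    (hl : Tendsto f (𝓝[>] a) (𝓝 l)) {x : ℝ} (hx : x ∈ Ioo a b) : l < f x := by
  obtain ⟨y, hay, hyx⟩ := exists_between hx.1
  have hy : y ∈ Ioo a b := ⟨hay, hyx.trans hx.2⟩
  refine lt_of_le_of_lt (le_of_tendsto hl ?_) (hf hy hx hyx)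
  filter_upwards [Ioo_mem_nhdsGT hay] with t ht
  exact (hf ⟨ht.1, ht.2.trans hy.2⟩ hy ht.2).le

theorem lt_of_strictMonoOn_of_tendsto_left {f : ℝ → ℝ} {a b l : ℝ} (hf : StrictMonoOn f (Ioo a b))
    (hl : Tendsto f (𝓝[<] b) (𝓝 l)) {x : ℝ} (hx : x ∈ Ioo a b) : f x < l := by
  obtain ⟨y, hxy, hyb⟩ := exists_between hx.2
  have hy : y ∈ Ioo a b := ⟨hx.1.trans hxy, hyb⟩
  refine lt_of_lt_of_le (hf hx hy hxy) (ge_of_tendsto hl ?_)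
  filter_upwards [Ioo_mem_nhdsLT hyb] with t ht
  exact (hf hy ⟨hy.1.trans ht.1, ht.2⟩ ht.1).le

end Monotone

/-! ### Zeros and poles of the quotient of Bessel functions, and interlacing. -/

section Zeros

/-- The numerator of the derivative of `x S_{n+1}(x) / S_n(x)`. -/
noncomputable def riccatiQuad (n : ℕ) (x : ℝ) : ℝ :=
  x * (riccatiS n x ^ 2 + riccatiS (n + 1) x ^ 2) -
    (2 * n + 1) * (riccatiS n x * riccatiS (n + 1) x)

theorem riccatiQuad_hasDerivAt {x : ℝ} (hx : x ≠ 0) (n : ℕ) :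
    HasDerivAt (riccatiQuad n) (2 * riccatiS n x ^ 2) x := by
  have h1 := riccatiS_hasDerivAt hx n
  have h2 := riccatiS_succ_hasDerivAt hx n
  refine (((hasDerivAt_id' x).fun_mul ((h1.fun_pow 2).fun_add (h2.fun_pow 2))).fun_sub
    ((h1.fun_mul h2).const_mul (2 * (n : ℝ) + 1))).congr_deriv ?_
  rw [riccatiS'_eq]
  field_simp
  ring

theorem riccatiQuad_tendsto (n : ℕ) : Tendsto (riccatiQuad n) (𝓝[>] 0) (𝓝 0) := by
  have h0 : Tendsto (fun x : ℝ => x) (𝓝[>] 0) (𝓝 0) := tendsto_nhdsWithin_of_tendsto_nhds tendsto_id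
  have h1 := riccatiS_tendsto_zero n
  have h2 := riccatiS_tendsto_zero (n + 1)
  have := (h0.mul ((h1.pow 2).add (h2.pow 2))).sub ((h1.mul h2).const_mul (2 * (n : ℝ) + 1))
  simp only [zero_mul, mul_zero, sub_zero] at this
  exact this

/-- The derivative $2S_n^2$ gives only weak monotonicity globally; strictness is gained on $(0,1)$,
where $S_n>0$, starting from the limit $0$ at the origin. -/
theorem riccatiQuad_pos (n : ℕ) {x : ℝ} (hx : 0 < x) : 0 < riccatiQuad n x := by
  have hc : ContinuousOn (riccatiQuad n) (Ioi 0) := fun y hy =>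
    (riccatiQuad_hasDerivAt (mem_Ioi.1 hy).ne' n).continuousAt.continuousWithinAt
  have hmono : MonotoneOn (riccatiQuad n) (Ioi 0) := by
    apply monotoneOn_of_deriv_nonneg (convex_Ioi 0) hc
    · intro y hy
      rw [interior_Ioi] at hy
      exact (riccatiQuad_hasDerivAt
        (mem_Ioi.1 hy).ne' n).differentiableAt.differentiableWithinAt
    · intro y hy
      rw [interior_Ioi] at hy
      rw [(riccatiQuad_hasDerivAt (mem_Ioi.1 hy).ne' n).deriv]
      positivity
  have hstrict : StrictMonoOn (riccatiQuad n) (Ioo 0 1) := by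
    apply strictMonoOn_of_deriv_pos (convex_Ioo 0 1) (hc.mono Ioo_subset_Ioi_self)
    intro y hy
    rw [interior_Ioo] at hy
    rw [(riccatiQuad_hasDerivAt hy.1.ne' n).deriv]
    have := riccatiS_pos n hy.1 hy.2.le
    positivity
  have hm : min x 1 / 2 ∈ Ioo (0 : ℝ) 1 :=
    ⟨by positivity, by linarith [min_le_right x 1]⟩
  have := lt_of_strictMonoOn_of_tendsto hstrict (riccatiQuad_tendsto n) hm
  refine this.trans_le (hmono hm.1 hx ?_)
  have := min_le_left x 1
  linarith [hm.1]

/-- At a common zero the positive quantity `riccatiQuad` would vanish. -/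
theorem riccatiS_succ_ne_zero {n : ℕ} {x : ℝ} (hx : 0 < x) (h : riccatiS n x = 0) :
    riccatiS (n + 1) x ≠ 0 := by
  intro h'
  have := riccatiQuad_pos n hx
  simp [riccatiQuad, h, h'] at this

theorem riccatiS'_ne_zero {n : ℕ} {x : ℝ} (hx : 0 < x) (h : riccatiS n x = 0) :
    riccatiS' n x ≠ 0 := by
  rw [riccatiS'_eq, h, mul_zero, zero_sub, neg_ne_zero]
  exact riccatiS_succ_ne_zero hx h

/-- The ratio `x J_{n + 3/2}(x) / J_{n + 1/2}(x)`. -/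
noncomputable def besselJRatio (n : ℕ) (x : ℝ) : ℝ := x * riccatiS (n + 1) x / riccatiS n x

theorem besselJRatio_hasDerivAt {n : ℕ} {x : ℝ} (hx : 0 < x) (h : riccatiS n x ≠ 0) :
    HasDerivAt (besselJRatio n) (riccatiQuad n x / riccatiS n x ^ 2) x := by
  have h1 := riccatiS_hasDerivAt hx.ne' n
  have h2 := riccatiS_succ_hasDerivAt hx.ne' n
  refine (((hasDerivAt_id' x).fun_mul h2).fun_div h1 h).congr_deriv ?_
  rw [riccatiS'_eq, riccatiQuad]
  field_simp
  ring

theorem besselJRatio_strictMonoOn {n : ℕ} {a b : ℝ} (ha : 0 ≤ a)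
    (h : ∀ x ∈ Ioo a b, riccatiS n x ≠ 0) : StrictMonoOn (besselJRatio n) (Ioo a b) := by
  apply strictMonoOn_of_deriv_pos (convex_Ioo a b)
  · exact fun x hx =>
      (besselJRatio_hasDerivAt (ha.trans_lt hx.1) (h x hx)).continuousAt.continuousWithinAt
  · intro x hx
    rw [interior_Ioo] at hx
    have hx0 := ha.trans_lt hx.1
    rw [(besselJRatio_hasDerivAt hx0 (h x hx)).deriv]
    have := h x hx
    exact div_pos (riccatiQuad_pos n hx0) (by positivity)

theorem besselJRatio_tendsto_zero (n : ℕ) : Tendsto (besselJRatio n) (𝓝[>] 0) (𝓝 0) := by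
  obtain ⟨c, hc, h⟩ := riccatiS_bounds n
  obtain ⟨_, -, h'⟩ := riccatiS_bounds (n + 1)
  have hu : Tendsto (fun x : ℝ => x ^ 2 / c) (𝓝[>] 0) (𝓝 0) := by
    have : Continuous (fun x : ℝ => x ^ 2 / c) := by fun_prop
    simpa using tendsto_nhdsWithin_of_tendsto_nhds (s := Ioi 0) (this.tendsto 0)
  refine tendsto_of_tendsto_of_tendsto_of_le_of_le' tendsto_const_nhds hu ?_ ?_
  · filter_upwards [Ioo_mem_nhdsGT one_pos] with x hx
    have := riccatiS_pos n hx.1 hx.2.le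
    have := riccatiS_pos (n + 1) hx.1 hx.2.le
    have := hx.1
    rw [besselJRatio]
    positivity
  · filter_upwards [Ioo_mem_nhdsGT one_pos] with x hx
    have h1 := riccatiS_pos n hx.1 hx.2.le
    have h2 := (h x hx.1 hx.2.le).1
    have h3 := (h' x hx.1 hx.2.le).2
    have h4 := hx.1
    rw [besselJRatio, div_le_div_iff₀ h1 hc]
    calc x * riccatiS (n + 1) x * c ≤ x * x ^ (n + 2) * c := by gcongr
      _ = x ^ 2 * (c * x ^ (n + 1)) := by ring
      _ ≤ x ^ 2 * riccatiS n x := by gcongr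

theorem riccatiS_mul_succ_hasDerivAt {n : ℕ} {x : ℝ} (hx : 0 < x) (h : riccatiS n x = 0) :
    HasDerivAt (fun x => riccatiS n x * riccatiS (n + 1) x) (-riccatiS (n + 1) x ^ 2) x := by
  refine ((riccatiS_hasDerivAt hx.ne' n).fun_mul
    (riccatiS_succ_hasDerivAt hx.ne' n)).congr_deriv ?_
  rw [riccatiS'_eq, h]
  ring

/-- Near a zero of $S_n$ the sign is now that of $S_nS_{n+1}$, whose derivative there is
$-S_{n+1}^2<0$. Hence every pole has the same orientation: $+\infty$ on its left, $-\infty$ on its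
right. -/
theorem besselJRatio_eq_mul_inv (n : ℕ) (x : ℝ) :
    besselJRatio n x = x * riccatiS (n + 1) x ^ 2 * (riccatiS n x * riccatiS (n + 1) x)⁻¹ := by
  rw [besselJRatio]
  by_cases h : riccatiS (n + 1) x = 0
  · simp [h]
  · by_cases h' : riccatiS n x = 0
    · simp [h']
    · field_simp

theorem riccatiS_mul_succ_sign {n : ℕ} {x : ℝ} (hx : 0 < x) (h : riccatiS n x = 0) :
    ∀ᶠ y in 𝓝 x, SignType.sign (riccatiS n y * riccatiS (n + 1) y) = SignType.sign (x - y) := by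
  have hd := riccatiS_mul_succ_hasDerivAt hx h
  refine eventually_nhdsWithin_sign_eq_of_deriv_neg ?_ (by simp [h])
  rw [hd.deriv]
  have := riccatiS_succ_ne_zero hx h
  have : 0 < riccatiS (n + 1) x ^ 2 := by positivity
  linarith

theorem besselJRatio_factor_tendsto {n : ℕ} {x : ℝ} (hx : 0 < x) :
    Tendsto (fun y => y * riccatiS (n + 1) y ^ 2) (𝓝 x) (𝓝 (x * riccatiS (n + 1) x ^ 2)) :=
  tendsto_id.mul ((riccatiS_hasDerivAt hx.ne' (n + 1)).continuousAt.tendsto.pow 2)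

theorem riccatiS_mul_succ_tendsto {n : ℕ} {x : ℝ} (hx : 0 < x) (h : riccatiS n x = 0) :
    Tendsto (fun y => riccatiS n y * riccatiS (n + 1) y) (𝓝 x) (𝓝 0) := by
  have := (riccatiS_mul_succ_hasDerivAt hx h).continuousAt.tendsto
  rwa [h, zero_mul] at this

theorem besselJRatio_tendsto_atTop {n : ℕ} {x : ℝ} (hx : 0 < x) (h : riccatiS n x = 0) :
    Tendsto (besselJRatio n) (𝓝[<] x) atTop := by
  have hb := riccatiS_succ_ne_zero hx h
  have h1 : Tendsto (fun y => riccatiS n y * riccatiS (n + 1) y) (𝓝[<] x) (𝓝[>] 0) := by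
    refine tendsto_nhdsWithin_iff.2
      ⟨tendsto_nhdsWithin_of_tendsto_nhds (riccatiS_mul_succ_tendsto hx h), ?_⟩
    filter_upwards [self_mem_nhdsWithin,
      eventually_nhdsWithin_of_eventually_nhds (riccatiS_mul_succ_sign hx h)] with y hy hs
    rw [sign_pos (sub_pos.2 hy)] at hs
    exact sign_eq_one_iff.1 hs
  have h2 := (tendsto_nhdsWithin_of_tendsto_nhds (s := Iio x)
    (besselJRatio_factor_tendsto (n := n) hx)).pos_mul_atTop (by positivity)
    (tendsto_inv_nhdsGT_zero.comp h1)
  exact h2.congr fun y => (besselJRatio_eq_mul_inv n y).symm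

theorem besselJRatio_tendsto_atBot {n : ℕ} {x : ℝ} (hx : 0 < x) (h : riccatiS n x = 0) :
    Tendsto (besselJRatio n) (𝓝[>] x) atBot := by
  have hb := riccatiS_succ_ne_zero hx h
  have h1 : Tendsto (fun y => riccatiS n y * riccatiS (n + 1) y) (𝓝[>] x) (𝓝[<] 0) := by
    refine tendsto_nhdsWithin_iff.2
      ⟨tendsto_nhdsWithin_of_tendsto_nhds (riccatiS_mul_succ_tendsto hx h), ?_⟩
    filter_upwards [self_mem_nhdsWithin,
      eventually_nhdsWithin_of_eventually_nhds (riccatiS_mul_succ_sign hx h)] with y hy hs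
    rw [sign_neg (sub_neg.2 hy)] at hs
    exact sign_eq_neg_one_iff.1 hs
  have h2 := (tendsto_nhdsWithin_of_tendsto_nhds (s := Ioi x)
    (besselJRatio_factor_tendsto (n := n) hx)).pos_mul_atBot (by positivity)
    (tendsto_inv_nhdsLT_zero.comp h1)
  exact h2.congr fun y => (besselJRatio_eq_mul_inv n y).symm

/-- The zeros stay away from the origin, so infinitely many would accumulate at a positive point.
There $S_n$ and $S_n'$ would both vanish, but zeros are simple. -/
theorem riccatiS_zeros_finite (n : ℕ) (c : ℝ) : {x | x ∈ Ioc 0 c ∧ riccatiS n x = 0}.Finite := by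
  by_contra hinf
  have hinf : {x | x ∈ Ioc 0 c ∧ riccatiS n x = 0}.Infinite := hinf
  have hsub : {x | x ∈ Ioc 0 c ∧ riccatiS n x = 0} ⊆ Icc 1 c := by
    intro x hx
    refine ⟨?_, hx.1.2⟩
    by_contra hlt
    exact (riccatiS_pos n hx.1.1 (not_le.1 hlt).le).ne' hx.2
  obtain ⟨x, hx, hacc⟩ := hinf.exists_accPt_of_subset_isCompact isCompact_Icc hsub
  have hx0 : 0 < x := one_pos.trans_le hx.1
  have hfreq : ∃ᶠ y in 𝓝[≠] x, riccatiS n y = 0 :=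
    (accPt_iff_frequently_nhdsNE.1 hacc).mono fun y hy => hy.2
  have hd := riccatiS_hasDerivAt hx0.ne' n
  have hzero : riccatiS n x = 0 := by
    by_contra hne
    have : ∀ᶠ y in 𝓝[≠] x, riccatiS n y ≠ 0 :=
      eventually_nhdsWithin_of_eventually_nhds (hd.continuousAt.eventually_ne hne)
    exact hfreq this
  exact hfreq (hd.eventually_ne (riccatiS'_ne_zero hx0 hzero))

/-- Rolle's theorem for $S_n/t^{n+1}$, whose derivative is $-S_{n+1}/t^{n+1}$. -/
theorem riccatiS_exists_zero_gt (n : ℕ) (c : ℝ) : ∃ x, c < x ∧ riccatiS n x = 0 := by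
  induction n generalizing c with
  | zero =>
    obtain ⟨k, hk⟩ := exists_nat_gt (c / Real.pi)
    exact ⟨k * Real.pi, (div_lt_iff₀ Real.pi_pos).1 hk, Real.sin_nat_mul_pi k⟩
  | succ n ih =>
    obtain ⟨x, hx, hx0⟩ := ih (max c 0)
    obtain ⟨y, hxy, hy0⟩ := ih x
    have hpos : 0 < x := (le_max_right _ _).trans_lt hx
    have hd (t : ℝ) (ht : 0 < t) : HasDerivAt (fun t => riccatiS n t / t ^ (n + 1))
        (-riccatiS (n + 1) t / t ^ (n + 1)) t := by
      refine ((riccatiS_hasDerivAt ht.ne' n).fun_div (hasDerivAt_pow (n + 1) t)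
        (pow_pos ht _).ne').congr_deriv ?_
      rw [riccatiS'_eq, Nat.add_sub_cancel]
      push_cast
      field_simp
      ring
    obtain ⟨z, hz, hz0⟩ := exists_hasDerivAt_eq_zero hxy
      (fun t ht => (hd t (hpos.trans_le ht.1)).continuousAt.continuousWithinAt)
      (by rw [hx0, hy0, zero_div, zero_div])
      (fun t ht => hd t (hpos.trans ht.1))
    refine ⟨z, (le_max_left _ _).trans_lt (hx.trans hz.1), ?_⟩
    have hz' : 0 < z := hpos.trans hz.1
    rw [div_eq_zero_iff, neg_eq_zero] at hz0
    exact hz0.resolve_right (pow_pos hz' _).ne'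

theorem riccatiS_exists_least_zero_gt (n : ℕ) {c : ℝ} (hc : 0 ≤ c) :
    ∃ x, IsLeast {x | c < x ∧ riccatiS n x = 0} x := by
  obtain ⟨y, hy, hy0⟩ := riccatiS_exists_zero_gt n c
  have hfin : {x | x ∈ Ioc c y ∧ riccatiS n x = 0}.Finite :=
    (riccatiS_zeros_finite n y).subset fun x hx => ⟨⟨hc.trans_lt hx.1.1, hx.1.2⟩, hx.2⟩
  obtain ⟨x, hx, hmin⟩ := exists_min_image _ id hfin ⟨y, ⟨hy, le_rfl⟩, hy0⟩
  refine ⟨x, ⟨hx.1.1, hx.2⟩, fun t ht => ?_⟩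
  by_cases hty : t ≤ y
  · exact hmin t ⟨⟨ht.1, hty⟩, ht.2⟩
  · exact hx.1.2.trans (not_le.1 hty).le

/-- Nonnegativity is part of the induction because $J_{n+1/2}$ and $S_n$ are known to share zeros
only at positive arguments. -/
theorem besselJZero_half_isLeast_aux (n s : ℕ) :
    0 ≤ besselJZero (n + 1 / 2) s ∧
      IsLeast {x | besselJZero (n + 1 / 2) s < x ∧ riccatiS n x = 0}
        (besselJZero (n + 1 / 2) (s + 1)) := by
  have key (s : ℕ) (h : 0 ≤ besselJZero (n + 1 / 2) s) :
      IsLeast {x | besselJZero (n + 1 / 2) s < x ∧ riccatiS n x = 0}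
        (besselJZero (n + 1 / 2) (s + 1)) := by
    obtain ⟨x, hx⟩ := riccatiS_exists_least_zero_gt n h
    have e : {x | besselJZero (n + 1 / 2) s < x ∧ besselJ (n + 1 / 2) x = 0} =
        {x | besselJZero (n + 1 / 2) s < x ∧ riccatiS n x = 0} := by
      ext t
      refine and_congr_right fun ht => besselJ_half_eq_zero_iff (h.trans_lt ht) n
    rw [besselJZero, e, hx.csInf_eq]
    exact hx
  induction s with
  | zero => exact ⟨le_rfl, key 0 le_rfl⟩
  | succ s ih =>
    have := ih.1.trans ih.2.1.1.le
    exact ⟨this, key _ this⟩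

theorem besselJZero_half_nonneg (n s : ℕ) : 0 ≤ besselJZero (n + 1 / 2) s :=
  (besselJZero_half_isLeast_aux n s).1

theorem besselJZero_half_isLeast (n s : ℕ) :
    IsLeast {x | besselJZero (n + 1 / 2) s < x ∧ riccatiS n x = 0}
      (besselJZero (n + 1 / 2) (s + 1)) :=
  (besselJZero_half_isLeast_aux n s).2

theorem besselJZero_half_strictMono (n : ℕ) : StrictMono (besselJZero (n + 1 / 2)) :=
  strictMono_nat_of_lt_succ fun s => (besselJZero_half_isLeast n s).1.1

theorem riccatiS_besselJZero (n s : ℕ) : riccatiS n (besselJZero (n + 1 / 2) (s + 1)) = 0 :=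
  (besselJZero_half_isLeast n s).1.2

theorem besselJZero_half_pos (n s : ℕ) : 0 < besselJZero (n + 1 / 2) (s + 1) :=
  (besselJZero_half_nonneg n s).trans_lt (besselJZero_half_strictMono n s.lt_succ_self)

theorem riccatiS_ne_zero_of_mem_Ioo {n s : ℕ} {x : ℝ}
    (hx : x ∈ Ioo (besselJZero (n + 1 / 2) s) (besselJZero (n + 1 / 2) (s + 1))) :
    riccatiS n x ≠ 0 :=
  fun h => hx.2.not_ge ((besselJZero_half_isLeast n s).2 ⟨hx.1, h⟩)

theorem exists_besselJZero_half_gt (n : ℕ) (c : ℝ) : ∃ s, c < besselJZero (n + 1 / 2) (s + 1) := by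
  by_contra! h
  have hinj : Function.Injective fun s => besselJZero (n + 1 / 2) (s + 1) :=
    (besselJZero_half_strictMono n).injective.comp (add_left_injective 1)
  exact infinite_of_injective_forall_mem hinj
    (fun s => (⟨⟨besselJZero_half_pos n s, h s⟩, riccatiS_besselJZero n s⟩ :
      besselJZero (n + 1 / 2) (s + 1) ∈ {x | x ∈ Ioc 0 c ∧ riccatiS n x = 0}))
    (riccatiS_zeros_finite n c)

theorem besselJRatio_strictMonoOn_zeros (n s : ℕ) : StrictMonoOn (besselJRatio n)
    (Ioo (besselJZero (n + 1 / 2) s) (besselJZero (n + 1 / 2) (s + 1))) :=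
  besselJRatio_strictMonoOn (besselJZero_half_nonneg n s)
    fun _ hx => riccatiS_ne_zero_of_mem_Ioo hx

theorem besselJRatio_continuousAt {n : ℕ} {x : ℝ} (hx : 0 < x) (h : riccatiS n x ≠ 0) :
    ContinuousAt (besselJRatio n) x := (besselJRatio_hasDerivAt hx h).continuousAt

/-- Write $z_s$, $y_s$ for the zeros of $S_n$, $S_{n+1}$. The quotient increases from $0$ on
$(y_s,z_{s+1})$, so $y_{s+1}$ is not there. It runs from $-\infty$ to $+\infty$ on
$(z_{s+1},z_{s+2})$, so it vanishes there. Carrying the right-hand limit lets the conventional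
$y_0=0$ start the induction. -/
theorem besselJZero_interlacing (n s : ℕ) :
    besselJZero (n + 1 / 2) s ≤ besselJZero ((n + 1 : ℕ) + 1 / 2) s ∧
      besselJZero ((n + 1 : ℕ) + 1 / 2) s < besselJZero (n + 1 / 2) (s + 1) ∧
      Tendsto (besselJRatio n) (𝓝[>] (besselJZero ((n + 1 : ℕ) + 1 / 2) s)) (𝓝 0) := by
  induction s with
  | zero => exact ⟨le_rfl, besselJZero_half_pos n 0, besselJRatio_tendsto_zero n⟩
  | succ s ih =>
    obtain ⟨h1, h2, h3⟩ := ih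
    set y := besselJZero ((n + 1 : ℕ) + 1 / 2)
    set z := besselJZero (n + 1 / 2)
    have hz : z (s + 1) < z (s + 2) := besselJZero_half_strictMono n (s + 1).lt_succ_self
    have hzpos : 0 < z (s + 1) := besselJZero_half_pos n s
    have hy := besselJZero_half_isLeast (n + 1) s
    have hypos : 0 < y (s + 1) := besselJZero_half_pos (n + 1) s
    have hmono := besselJRatio_strictMonoOn_zeros n s
    have hyroot : besselJRatio n (y (s + 1)) = 0 := by
      rw [besselJRatio, hy.1.2, mul_zero, zero_div]
    obtain ⟨η, hη, hη0⟩ : ∃ η ∈ Ioo (z (s + 1)) (z (s + 2)), besselJRatio n η = 0 := by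
      have hbot := (besselJRatio_tendsto_atBot hzpos (riccatiS_besselJZero n s)).eventually
        (eventually_lt_atBot 0)
      have htop := (besselJRatio_tendsto_atTop (besselJZero_half_pos n (s + 1))
        (riccatiS_besselJZero n (s + 1))).eventually (eventually_gt_atTop 0)
      obtain ⟨p, hp, hpI⟩ := (hbot.and (Ioo_mem_nhdsGT hz)).exists
      obtain ⟨q, hq, hqI⟩ := (htop.and (Ioo_mem_nhdsLT hz)).exists
      have hc : ContinuousOn (besselJRatio n) (Ioo (z (s + 1)) (z (s + 2))) := fun x hx =>
        (besselJRatio_continuousAt (hzpos.trans hx.1)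
          (riccatiS_ne_zero_of_mem_Ioo hx)).continuousWithinAt
      exact isPreconnected_Ioo.intermediate_value hpI hqI hc ⟨hp.le, hq.le⟩
    have hη1 : riccatiS (n + 1) η = 0 := by
      have hηpos := hzpos.trans hη.1
      rw [besselJRatio, div_eq_zero_iff, mul_eq_zero] at hη0
      exact (hη0.resolve_right (riccatiS_ne_zero_of_mem_Ioo hη)).resolve_left hηpos.ne'
    refine ⟨?_, (hy.2 ⟨h2.trans hη.1, hη1⟩).trans_lt hη.2, ?_⟩
    · by_contra hlt
      have := lt_of_strictMonoOn_of_tendsto (hmono.mono (Ioo_subset_Ioo_left h1)) h3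
        ⟨hy.1.1, not_le.1 hlt⟩
      exact this.ne' hyroot
    · have hne : riccatiS n (y (s + 1)) ≠ 0 := fun h => riccatiS_succ_ne_zero hypos h hy.1.2
      have := (besselJRatio_continuousAt hypos hne).tendsto
      rw [hyroot] at this
      exact tendsto_nhdsWithin_of_tendsto_nhds this

end Zeros

/-! ### Linear second-order equations and square integrability. -/

section Wronskian

/-- The Wronskian of two solutions of `y'' = V y` is constant. -/
theorem exists_wronskian_eq_const {I : Set ℝ} (hI : IsOpen I) (hI' : IsPreconnected I)
    {u u' : ℝ → ℂ} {p p' V : ℝ → ℝ}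
    (hu : ∀ r ∈ I, HasDerivAt u (u' r) r) (hu' : ∀ r ∈ I, HasDerivAt u' (V r * u r) r)
    (hp : ∀ r ∈ I, HasDerivAt p (p' r) r) (hp' : ∀ r ∈ I, HasDerivAt p' (V r * p r) r) :
    ∃ a : ℂ, ∀ r ∈ I, u r * p' r - u' r * p r = a := by
  have hd (r : ℝ) (hr : r ∈ I) : HasDerivAt (fun r => u r * p' r - u' r * p r) 0 r := by
    refine (((hu r hr).fun_mul (hp' r hr).ofReal_comp).fun_sub
      ((hu' r hr).fun_mul (hp r hr).ofReal_comp)).congr_deriv ?_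
    push_cast
    ring
  exact hI.exists_is_const_of_deriv_eq_zero hI'
    (fun r hr => (hd r hr).differentiableAt.differentiableWithinAt) (fun r hr => (hd r hr).deriv)

/-- Two solutions of `y'' = V y` with nonzero Wronskian span the solutions. -/
theorem exists_eq_linear_combination {I : Set ℝ} (hI : IsOpen I) (hI' : IsPreconnected I)
    {u u' : ℝ → ℂ} {p p' q q' V : ℝ → ℝ} {c : ℝ} (hc : c ≠ 0)
    (hu : ∀ r ∈ I, HasDerivAt u (u' r) r) (hu' : ∀ r ∈ I, HasDerivAt u' (V r * u r) r)
    (hp : ∀ r ∈ I, HasDerivAt p (p' r) r) (hp' : ∀ r ∈ I, HasDerivAt p' (V r * p r) r)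
    (hq : ∀ r ∈ I, HasDerivAt q (q' r) r) (hq' : ∀ r ∈ I, HasDerivAt q' (V r * q r) r)
    (hW : ∀ r ∈ I, p r * q' r - p' r * q r = c) :
    ∃ A B : ℂ, ∀ r ∈ I, u r = A * p r + B * q r ∧ u' r = A * p' r + B * q' r := by
  obtain ⟨a, ha⟩ := exists_wronskian_eq_const hI hI' hu hu' hp hp'
  obtain ⟨b, hb⟩ := exists_wronskian_eq_const hI hI' hu hu' hq hq'
  have hc' : (c : ℂ) ≠ 0 := Complex.ofReal_ne_zero.2 hc
  -- Cramer's rule: pairing with $q$ isolates the coefficient of $p$, and pairing with $p$ isolates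
  -- that of $q$ up to sign.
  refine ⟨b / c, -a / c, fun r hr => ?_⟩
  have hw : (p r : ℂ) * q' r - p' r * q r = c := by
    rw [← hW r hr]
    push_cast
    ring
  rw [← ha r hr, ← hb r hr]
  constructor
  · field_simp
    linear_combination -u r * hw
  · field_simp
    linear_combination -u' r * hw

theorem hasDerivAt_scaled {F F' : ℝ → ℝ} (hF : ∀ {x : ℝ}, x ≠ 0 → HasDerivAt F (F' x) x) {k r : ℝ}
    (hk : k ≠ 0) (hr : r ≠ 0) : HasDerivAt (fun r => F (k * r)) (k * F' (k * r)) r := by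
  have h := (hF (mul_ne_zero hk hr)).comp r ((hasDerivAt_id' r).const_mul k)
  refine (h : HasDerivAt (fun r => F (k * r)) _ r).congr_deriv ?_
  ring

theorem hasDerivAt_scaled_deriv {F F' : ℝ → ℝ} {c d : ℝ}
    (hF : ∀ {x : ℝ}, x ≠ 0 → HasDerivAt F' ((c / x ^ 2 + d) * F x) x) {k r : ℝ}
    (hk : k ≠ 0) (hr : r ≠ 0) :
    HasDerivAt (fun r => k * F' (k * r)) ((c / r ^ 2 + d * k ^ 2) * F (k * r)) r := by
  have h := ((hF (mul_ne_zero hk hr)).comp r ((hasDerivAt_id' r).const_mul k)).const_mul k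
  refine (h : HasDerivAt (fun r => k * F' (k * r)) _ r).congr_deriv ?_
  field_simp

theorem tendsto_scaled_nhdsGT_zero {k : ℝ} (hk : 0 < k) :
    Tendsto (fun r : ℝ => k * r) (𝓝[>] 0) (𝓝[>] 0) := by
  refine tendsto_nhdsWithin_iff.2 ⟨?_, ?_⟩
  · have : Continuous (fun r : ℝ => k * r) := by fun_prop
    simpa using tendsto_nhdsWithin_of_tendsto_nhds (s := Ioi 0) (this.tendsto 0)
  · filter_upwards [self_mem_nhdsWithin] with r hr using mul_pos hk hr

theorem riccatiK_tendsto_atTop (n : ℕ) : Tendsto (riccatiK n) atTop (𝓝 0) := by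
  obtain ⟨B, hB⟩ := riccatiK_le n one_pos
  have h := Real.tendsto_exp_neg_atTop_nhds_zero.const_mul B
  rw [mul_zero] at h
  refine tendsto_of_tendsto_of_tendsto_of_le_of_le' tendsto_const_nhds h ?_ ?_
  · filter_upwards [eventually_gt_atTop 0] with x hx using (riccatiK_pos n hx).le
  · filter_upwards [eventually_ge_atTop 1] with x hx using hB x hx

/-- The set where $|u|\ge1$ contains a half-line, whereas Chebyshev's inequality makes it of finite
measure. -/
theorem not_memLp_of_tendsto_norm_atTop {u : ℝ → ℂ} (h : Tendsto (fun r => ‖u r‖) atTop atTop) :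
    ¬ MemLp u 2 (volume.restrict (Ioi (0 : ℝ))) := by
  intro hu
  obtain ⟨c, hc⟩ := (h.eventually (eventually_ge_atTop 1)).exists_forall_of_atTop
  have h1 := hu.meas_ge_lt_top (by norm_num) (by norm_num) (ε := 1) one_ne_zero
  have h2 : volume.restrict (Ioi (0 : ℝ)) (Ioi (max c 0)) ≤
      volume.restrict (Ioi (0 : ℝ)) {x | (1 : NNReal) ≤ ‖u x‖₊} :=
    measure_mono fun r hr => hc r ((le_max_left _ _).trans (mem_Ioi.1 hr).le)
  rw [Measure.restrict_apply measurableSet_Ioi,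
    inter_eq_left.2 (Ioi_subset_Ioi (le_max_right c 0)), Real.volume_Ioi] at h2
  exact (h2.trans_lt h1).false

/-- A function that agrees on an open set with a real solution of `y'' = V y` solves it. -/
theorem solution_of_eqOn {I : Set ℝ} (hI : IsOpen I) {u : ℝ → ℂ} {p p' V : ℝ → ℝ}
    (hu : ∀ r ∈ I, u r = p r)
    (hp : ∀ r ∈ I, HasDerivAt p (p' r) r) (hp' : ∀ r ∈ I, HasDerivAt p' (V r * p r) r)
    {r : ℝ} (hr : r ∈ I) :
    DifferentiableAt ℝ u r ∧ deriv u r = p' r ∧ HasDerivAt (deriv u) (V r * u r) r := by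
  have hd (r : ℝ) (hr : r ∈ I) : HasDerivAt u (p' r) r :=
    (hp r hr).ofReal_comp.congr_of_eventuallyEq
      (Filter.eventually_of_mem (hI.mem_nhds hr) hu)
  refine ⟨(hd r hr).differentiableAt, (hd r hr).deriv, ?_⟩
  have h := (hp' r hr).ofReal_comp.congr_of_eventuallyEq
    (Filter.eventually_of_mem (hI.mem_nhds hr) fun t ht => (hd t ht).deriv)
  rw [hu r hr]
  exact_mod_cast h

end Wronskian

/-! ### The radial equation on either side of the edge. -/

namespace DeltaWell

theorem v0_pos (W : DeltaWell) : 0 < W.v0 := by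
  have := W.hbar_pos
  have := W.mu_pos
  have := W.V0_pos
  have := W.R_pos
  exact Real.sqrt_pos.2 (by positivity)

theorem v0_sq (W : DeltaWell) : W.v0 ^ 2 = 2 * W.mu / W.hbar ^ 2 * W.V0 * W.R ^ 2 := by
  have := W.hbar_pos
  have := W.mu_pos
  have := W.V0_pos
  have := W.R_pos
  rw [v0, Real.sq_sqrt (by positivity)]
  ring

theorem potential_interior (W : DeltaWell) {ε r : ℝ} (hε : ε ≤ 1) (hr : r < W.R) :
    2 * W.mu / W.hbar ^ 2 * (W.potential r - -(ε * W.V0)) =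
      -1 * (W.v0 * √(1 - ε) / W.R) ^ 2 := by
  have := W.R_pos.ne'
  rw [potential, if_pos hr, div_pow, mul_pow, v0_sq, Real.sq_sqrt (by linarith)]
  field_simp
  ring

theorem potential_exterior (W : DeltaWell) {ε r : ℝ} (hε : 0 ≤ ε) (hr : W.R ≤ r) :
    2 * W.mu / W.hbar ^ 2 * (W.potential r - -(ε * W.V0)) = 1 * (W.v0 * √ε / W.R) ^ 2 := by
  have := W.R_pos.ne'
  rw [potential, if_neg hr.not_gt, div_pow, mul_pow, v0_sq, Real.sq_sqrt hε]
  field_simp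
  ring

/-- The interior solutions, with their derivatives, solve the radial equation. -/
theorem interior_hasDerivAt (W : DeltaWell) (ℓ : ℕ) {ε : ℝ} (hε : ε < 1) {F F' : ℝ → ℝ}
    (hF : ∀ {x : ℝ}, x ≠ 0 → HasDerivAt F (F' x) x)
    (hF' : ∀ {x : ℝ}, x ≠ 0 → HasDerivAt F' ((ℓ * (ℓ + 1) / x ^ 2 - 1) * F x) x)
    {k : ℝ} (hk : k = W.v0 * √(1 - ε) / W.R) {r : ℝ} (hr : r ∈ Ioo 0 W.R) :
    HasDerivAt (fun r => F (k * r)) (k * F' (k * r)) r ∧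
    HasDerivAt (fun r => k * F' (k * r))
      ((ℓ * (ℓ + 1) / r ^ 2 + 2 * W.mu / W.hbar ^ 2 * (W.potential r - -(ε * W.V0))) *
        F (k * r)) r := by
  have hk0 : k ≠ 0 := by
    rw [hk]
    exact (div_pos (mul_pos W.v0_pos (Real.sqrt_pos.2 (by linarith))) W.R_pos).ne'
  rw [potential_interior W hε.le hr.2, ← hk]
  exact ⟨hasDerivAt_scaled hF hk0 hr.1.ne', hasDerivAt_scaled_deriv (d := -1) hF' hk0 hr.1.ne'⟩

/-- The exterior solutions, with their derivatives, solve the radial equation. -/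
theorem exterior_hasDerivAt (W : DeltaWell) (ℓ : ℕ) {ε : ℝ} (hε : 0 < ε) {F F' : ℝ → ℝ}
    (hF : ∀ {x : ℝ}, x ≠ 0 → HasDerivAt F (F' x) x)
    (hF' : ∀ {x : ℝ}, x ≠ 0 → HasDerivAt F' ((ℓ * (ℓ + 1) / x ^ 2 + 1) * F x) x)
    {k : ℝ} (hk : k = W.v0 * √ε / W.R) {r : ℝ} (hr : r ∈ Ioi W.R) :
    HasDerivAt (fun r => F (k * r)) (k * F' (k * r)) r ∧
    HasDerivAt (fun r => k * F' (k * r))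
      ((ℓ * (ℓ + 1) / r ^ 2 + 2 * W.mu / W.hbar ^ 2 * (W.potential r - -(ε * W.V0))) *
        F (k * r)) r := by
  have hk0 : k ≠ 0 := by
    rw [hk]
    exact (div_pos (mul_pos W.v0_pos (Real.sqrt_pos.2 hε)) W.R_pos).ne'
  have hr0 : r ≠ 0 := (W.R_pos.trans hr).ne'
  rw [potential_exterior W hε.le (mem_Ioi.1 hr).le, ← hk]
  exact ⟨hasDerivAt_scaled hF hk0 hr0, hasDerivAt_scaled_deriv hF' hk0 hr0⟩

/-- The condition at the origin excludes the irregular solution even for $\ell=0$, where that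
solution is bounded but tends to $1$. -/
theorem IsBoundState.interior {W : DeltaWell} {ℓ : ℕ} {ε : ℝ} {u : ℝ → ℂ}
    (h : W.IsBoundState ℓ (-(ε * W.V0)) u) (hε : ε < 1) {k : ℝ}
    (hk : k = W.v0 * √(1 - ε) / W.R) :
    ∃ A : ℂ, ∀ r ∈ Ioo 0 W.R, u r = A * riccatiS ℓ (k * r) ∧
      deriv u r = A * (k * riccatiS' ℓ (k * r) : ℝ) := by
  have hk0 : 0 < k := by
    rw [hk]
    exact div_pos (mul_pos W.v0_pos (Real.sqrt_pos.2 (by linarith))) W.R_pos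
  have hs := fun r hr => W.interior_hasDerivAt ℓ hε (fun hx => riccatiS_hasDerivAt hx ℓ)
    (fun hx => riccatiS'_hasDerivAt hx ℓ) hk (r := r) hr
  have hc := fun r hr => W.interior_hasDerivAt ℓ hε (fun hx => riccatiC_hasDerivAt hx ℓ)
    (fun hx => riccatiC'_hasDerivAt hx ℓ) hk (r := r) hr
  obtain ⟨A, B, hAB⟩ := exists_eq_linear_combination (c := -k) isOpen_Ioo isPreconnected_Ioo
    (neg_ne_zero.2 hk0.ne')
    (fun r hr => (h.differentiable r hr.1 hr.2.ne).hasDerivAt)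
    (fun r hr => h.schrodinger r hr.1 hr.2.ne)
    (fun r hr => (hs r hr).1) (fun r hr => (hs r hr).2)
    (fun r hr => (hc r hr).1) (fun r hr => (hc r hr).2)
    (fun r hr => by linear_combination k * riccatiS_wronskian (k * r) ℓ)
  suffices hB : B = 0 by
    refine ⟨A, fun r hr => ?_⟩
    have := hAB r hr
    simpa [hB] using this
  by_contra hB
  have hS : Tendsto (fun r => (riccatiS ℓ (k * r) : ℂ)) (𝓝[>] 0) (𝓝 0) := by
    have := (riccatiS_tendsto_zero ℓ).comp (tendsto_scaled_nhdsGT_zero hk0)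
    exact_mod_cast (Complex.continuous_ofReal.tendsto 0).comp this
  have h1 := ((h.origin.sub (hS.const_mul A)).div_const B)
  rw [mul_zero, sub_zero, zero_div] at h1
  have h2 : Tendsto (fun r => (riccatiC ℓ (k * r) : ℂ)) (𝓝[>] 0) (𝓝 0) := by
    refine h1.congr' ?_
    filter_upwards [Ioo_mem_nhdsGT W.R_pos] with r hr
    rw [(hAB r hr).1]
    field_simp
    ring
  have h3 : Tendsto (fun r => riccatiC ℓ (k * r)) (𝓝[>] 0) (𝓝 0) :=
    (Complex.continuous_re.tendsto 0).comp h2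
  have h4 := h3.comp (tendsto_scaled_nhdsGT_zero (inv_pos.2 hk0))
  refine riccatiC_not_tendsto_zero ℓ (h4.congr fun x => ?_)
  simp only [Function.comp]
  rw [mul_inv_cancel_left₀ hk0.ne']

/-- A nonzero coefficient of the growing solution would force $|u|\to\infty$, against square
integrability. -/
theorem IsBoundState.exterior {W : DeltaWell} {ℓ : ℕ} {ε : ℝ} {u : ℝ → ℂ}
    (h : W.IsBoundState ℓ (-(ε * W.V0)) u) (hε : 0 < ε) {k : ℝ}
    (hk : k = W.v0 * √ε / W.R) :
    ∃ A : ℂ, ∀ r ∈ Ioi W.R, u r = A * riccatiK ℓ (k * r) ∧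
      deriv u r = A * (k * riccatiK' ℓ (k * r) : ℝ) := by
  have hk0 : 0 < k := by
    rw [hk]
    exact div_pos (mul_pos W.v0_pos (Real.sqrt_pos.2 hε)) W.R_pos
  have hs := fun r hr => W.exterior_hasDerivAt ℓ hε (fun hx => riccatiK_hasDerivAt hx ℓ)
    (fun hx => riccatiK'_hasDerivAt hx ℓ) hk (r := r) hr
  have hc := fun r hr => W.exterior_hasDerivAt ℓ hε (fun hx => riccatiI_hasDerivAt hx ℓ)
    (fun hx => riccatiI'_hasDerivAt hx ℓ) hk (r := r) hr
  obtain ⟨A, B, hAB⟩ := exists_eq_linear_combination (c := k * (2 * (-1) ^ ℓ)) isOpen_Ioi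
    isPreconnected_Ioi (mul_ne_zero hk0.ne' (by simp))
    (fun r hr => (h.differentiable r (W.R_pos.trans hr) (mem_Ioi.1 hr).ne').hasDerivAt)
    (fun r hr => h.schrodinger r (W.R_pos.trans hr) (mem_Ioi.1 hr).ne')
    (fun r hr => (hs r hr).1) (fun r hr => (hs r hr).2)
    (fun r hr => (hc r hr).1) (fun r hr => (hc r hr).2)
    (fun r hr => by linear_combination k * riccatiK_wronskian (k * r) ℓ)
  suffices hB : B = 0 by
    refine ⟨A, fun r hr => ?_⟩
    have := hAB r hr
    simpa [hB] using this
  by_contra hB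
  have hlin : Tendsto (fun r : ℝ => k * r) atTop atTop := tendsto_id.const_mul_atTop hk0
  have h1 := ((riccatiI_tendsto_abs ℓ).comp hlin).const_mul_atTop (norm_pos_iff.2 hB)
  have h2 := (((riccatiK_tendsto_atTop ℓ).comp hlin).abs.const_mul ‖A‖).neg
  refine not_memLp_of_tendsto_norm_atTop ?_ h.square_integrable
  refine tendsto_atTop_mono' _ ?_ (h1.atTop_add h2)
  filter_upwards [eventually_gt_atTop W.R] with r hr
  rw [(hAB r hr).1]
  have := norm_sub_le_norm_add (B * riccatiI ℓ (k * r)) (A * riccatiK ℓ (k * r))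
  simp only [norm_mul, Complex.norm_real, Real.norm_eq_abs] at this
  rw [add_comm (A * _)]
  simpa [sub_eq_add_neg] using this

/-- The matching conditions in terms of the logarithmic derivatives. -/
theorem matching_iff_secular {β : ℝ} (hβ : β ≠ 2) (hβ' : β ≠ -2) (L w φ q : ℝ) :
    (2 + β) / (2 - β) * (L - q) = w / (4 - β ^ 2) + (2 - β) / (2 + β) * (L - φ) ↔
      φ = (2 + β) ^ 2 / (2 - β) ^ 2 * q - 8 * β * L / (2 - β) ^ 2 + w / (2 - β) ^ 2 := by
  have h1 : 2 - β ≠ 0 := sub_ne_zero.2 hβ.symm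
  have h2 : 2 + β ≠ 0 := fun h => hβ' (by linarith)
  have h3 : 4 - β ^ 2 = (2 - β) * (2 + β) := by ring
  rw [h3]
  field_simp
  constructor <;> intro h <;> linarith

end DeltaWell

/-! ### Equivalence of bound states and solutions of the secular equation. -/

namespace DeltaWell

/-- The matching conditions at the edge, for amplitudes `A` inside and `C` outside, in terms of
the values `S`, `S1` of `riccatiS` and `K`, `K1` of `riccatiK`. -/
theorem secular_of_matching {β w L χ σ S S1 K K1 : ℝ} {A C : ℂ} (hβ : β ≠ 2) (hβ' : β ≠ -2)
    (hχ : χ ≠ 0) (hK : K ≠ 0) (hS : S = 0 → S1 ≠ 0) (hAC : ¬ (A = 0 ∧ C = 0))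
    (h1 : C * K = ((2 + β) / (2 - β) : ℝ) * (A * S))
    (h2 : C * (L * K - σ * K1 : ℝ) =
      (w / (4 - β ^ 2) : ℝ) * (A * S) + ((2 - β) / (2 + β) : ℝ) * (A * (L * S - χ * S1 : ℝ))) :
    S ≠ 0 ∧ χ * S1 / S =
      (2 + β) ^ 2 / (2 - β) ^ 2 * (σ * K1 / K) - 8 * β * L / (2 - β) ^ 2 + w / (2 - β) ^ 2 := by
  have hKc : (K : ℂ) ≠ 0 := Complex.ofReal_ne_zero.2 hK
  have hA : A ≠ 0 := by
    rintro rfl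
    rw [zero_mul, mul_zero, mul_eq_zero, or_iff_left hKc] at h1
    exact hAC ⟨rfl, h1⟩
  have hg : (2 - β) / (2 + β) ≠ 0 :=
    div_ne_zero (sub_ne_zero.2 hβ.symm) fun h => hβ' (by linarith)
  -- If $S=0$, continuity of values up to a factor gives $C=0$. The derivative condition then forces
  -- $S_1=0$, which `hS` excludes.
  have hS0 : S ≠ 0 := by
    intro h
    have hC : C = 0 := by
      rw [h, Complex.ofReal_zero, mul_zero, mul_zero, mul_eq_zero, or_iff_left hKc] at h1
      exact h1
    rw [hC, h, zero_mul, Complex.ofReal_zero, mul_zero, mul_zero, zero_add, eq_comm, mul_eq_zero,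
      mul_eq_zero, or_iff_right (Complex.ofReal_ne_zero.2 hg), or_iff_right hA,
      Complex.ofReal_eq_zero, mul_zero, zero_sub, neg_eq_zero, mul_eq_zero, or_iff_right hχ] at h2
    exact hS h h2
  refine ⟨hS0, (matching_iff_secular hβ hβ' L w _ _).1 ?_⟩
  -- Eliminating $C$ and cancelling $A$ leaves a relation between real numbers.
  have h3 : ((2 + β) / (2 - β) * S * (L * K - σ * K1) : ℝ) =
      w / (4 - β ^ 2) * S * K + (2 - β) / (2 + β) * (L * S - χ * S1) * K := by
    rw [← Complex.ofReal_inj]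
    refine mul_left_cancel₀ hA ?_
    simp only [Complex.ofReal_add, Complex.ofReal_mul]
    linear_combination (K : ℂ) * h2 - (L * K - σ * K1 : ℝ) * h1
  have h4 : (L - σ * K1 / K) = (L * K - σ * K1) / K := by field_simp
  have h5 : (L - χ * S1 / S) = (L * S - χ * S1) / S := by field_simp
  rw [h4, h5, ← mul_right_inj' (mul_ne_zero hS0 hK)]
  calc S * K * ((2 + β) / (2 - β) * ((L * K - σ * K1) / K))
      = (2 + β) / (2 - β) * S * (L * K - σ * K1) * (K / K) := by ring
    _ = w / (4 - β ^ 2) * S * K + (2 - β) / (2 + β) * (L * S - χ * S1) * K * (S / S) := by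
        rw [div_self hK, div_self hS0, mul_one, mul_one, h3]
    _ = _ := by ring

theorem mul_R_cancel (W : DeltaWell) (x : ℝ) : x / W.R * W.R = x :=
  div_mul_cancel₀ _ W.R_pos.ne'

theorem tendsto_scaled {F : ℝ → ℝ} {k R : ℝ} (hF : ContinuousAt F (k * R)) (A : ℂ) {s : Set ℝ} :
    Tendsto (fun r => A * F (k * r)) (𝓝[s] R) (𝓝 (A * F (k * R))) := by
  have h1 : ContinuousAt (fun r : ℝ => k * r) R := by fun_prop
  have h2 : ContinuousAt (fun r => F (k * r)) R := ContinuousAt.comp hF h1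
  have h3 := (Complex.continuous_ofReal.continuousAt.comp h2).tendsto.const_mul A
  exact tendsto_nhdsWithin_of_tendsto_nhds h3

theorem IsBoundState.secular {W : DeltaWell} (hβ : W.β ≠ 2) (hβ' : W.β ≠ -2) {ℓ : ℕ} {ε : ℝ}
    (hε : ε ∈ Ioo (0 : ℝ) 1) {u : ℝ → ℂ} (h : W.IsBoundState ℓ (-(ε * W.V0)) u) :
    riccatiS ℓ (W.v0 * √(1 - ε)) ≠ 0 ∧
      besselJRatio ℓ (W.v0 * √(1 - ε)) = secularRHS ℓ W.β W.w (W.v0 * √ε) := by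
  obtain ⟨A, hA⟩ := h.interior hε.2 rfl
  obtain ⟨C, hC⟩ := h.exterior hε.1 rfl
  set χ := W.v0 * √(1 - ε)
  set σ := W.v0 * √ε
  have hR := W.R_pos
  have hχ : 0 < χ := mul_pos W.v0_pos (Real.sqrt_pos.2 (by linarith [hε.2]))
  have hσ : 0 < σ := mul_pos W.v0_pos (Real.sqrt_pos.2 hε.1)
  obtain ⟨a, a', b, b', ha, ha', hb, hb', hab, hab'⟩ := h.matching
  have eχ := W.mul_R_cancel χ
  have eσ := W.mul_R_cancel σ
  have c1 : ContinuousAt (riccatiS ℓ) (χ / W.R * W.R) := by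
    rw [eχ]; exact (riccatiS_hasDerivAt hχ.ne' ℓ).continuousAt
  have c2 : ContinuousAt (fun x => χ / W.R * riccatiS' ℓ x) (χ / W.R * W.R) := by
    rw [eχ]; exact ((riccatiS'_hasDerivAt hχ.ne' ℓ).const_mul _).continuousAt
  have c3 : ContinuousAt (riccatiK ℓ) (σ / W.R * W.R) := by
    rw [eσ]; exact (riccatiK_hasDerivAt hσ.ne' ℓ).continuousAt
  have c4 : ContinuousAt (fun x => σ / W.R * riccatiK' ℓ x) (σ / W.R * W.R) := by
    rw [eσ]; exact ((riccatiK'_hasDerivAt hσ.ne' ℓ).const_mul _).continuousAt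
  have l1 := tendsto_nhds_unique (ha.congr' (Filter.eventually_of_mem (Ioo_mem_nhdsLT hR)
    fun r hr => (hA r hr).1)) (tendsto_scaled c1 A)
  have l2 := tendsto_nhds_unique (ha'.congr' (Filter.eventually_of_mem (Ioo_mem_nhdsLT hR)
    fun r hr => (hA r hr).2)) (tendsto_scaled c2 A)
  have l3 := tendsto_nhds_unique (hb.congr' (Filter.eventually_of_mem self_mem_nhdsWithin
    fun r hr => (hC r hr).1)) (tendsto_scaled c3 C)
  have l4 := tendsto_nhds_unique (hb'.congr' (Filter.eventually_of_mem self_mem_nhdsWithin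
    fun r hr => (hC r hr).2)) (tendsto_scaled c4 C)
  rw [eχ] at l1 l2
  rw [eσ] at l3 l4
  rw [l1, l3] at hab
  rw [l1, l2, l4] at hab'
  have hAC : ¬ (A = 0 ∧ C = 0) := by
    rintro ⟨rfl, rfl⟩
    obtain ⟨r, hr0, hrR, hr⟩ := h.nonzero
    rcases lt_or_gt_of_ne hrR with hlt | hgt
    · exact hr (by rw [(hA r ⟨hr0, hlt⟩).1, zero_mul])
    · exact hr (by rw [(hC r hgt).1, zero_mul])
  -- The derivative condition is multiplied by $R$: it becomes dimensionless, and $4\alpha$ becomes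
  -- $w$.
  have e1 : W.R * (χ / W.R * riccatiS' ℓ χ) =
      (ℓ + 1) * riccatiS ℓ χ - χ * riccatiS (ℓ + 1) χ := by
    rw [riccatiS'_eq]
    field_simp
  have e2 : W.R * (σ / W.R * riccatiK' ℓ σ) =
      (ℓ + 1) * riccatiK ℓ σ - σ * riccatiK (ℓ + 1) σ := by
    rw [riccatiK'_eq]
    field_simp
  have e3 : W.w / (4 - W.β ^ 2) = W.R * (4 * W.α / (4 - W.β ^ 2)) := by
    rw [w]
    ring
  have := secular_of_matching (L := ℓ + 1) (w := W.w) (χ := χ) (σ := σ) hβ hβ' hχ.ne'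
    (riccatiK_pos ℓ hσ).ne' (riccatiS_succ_ne_zero hχ) hAC hab (by
      rw [← e1, ← e2, e3]
      simp only [Complex.ofReal_mul] at hab' ⊢
      linear_combination (W.R : ℂ) * hab')
  rw [secularRHS_eq _ _ _ hσ]
  exact this

theorem memLp_of_norm_le_exp {u : ℝ → ℂ} {M k : ℝ} (hk : 0 < k)
    (hu : AEStronglyMeasurable u (volume.restrict (Ioi (0 : ℝ))))
    (h : ∀ r, 0 < r → ‖u r‖ ≤ M * Real.exp (-k * r)) :
    MemLp u 2 (volume.restrict (Ioi (0 : ℝ))) := by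
  have hg : MemLp (fun r => M * Real.exp (-k * r)) 2 (volume.restrict (Ioi (0 : ℝ))) := by
    refine (memLp_two_iff_integrable_sq (by fun_prop)).2 ?_
    have h1 : IntegrableOn (fun r => M ^ 2 * Real.exp (-(2 * k) * r)) (Ioi 0) :=
      (exp_neg_integrableOn_Ioi 0 (by positivity)).const_mul _
    refine h1.congr (Eventually.of_forall fun r => ?_)
    simp only [mul_pow, ← Real.exp_nat_mul]
    push_cast
    ring_nf
  refine hg.mono hu ?_
  filter_upwards [ae_restrict_mem measurableSet_Ioi] with r hr
  exact (h r hr).trans (le_abs_self _)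

theorem riccatiS_bounded (n : ℕ) (c : ℝ) : ∃ M, ∀ x, 0 < x → x ≤ c → |riccatiS n x| ≤ M := by
  obtain ⟨d, -, hd⟩ := riccatiS_bounds n
  obtain ⟨M, hM⟩ := isCompact_Icc.exists_bound_of_continuousOn (s := Icc 1 c) (f := riccatiS n)
    fun x hx => (riccatiS_hasDerivAt
      (one_pos.trans_le hx.1).ne' n).continuousAt.continuousWithinAt
  refine ⟨max 1 M, fun x hx hxc => ?_⟩
  rcases le_total x 1 with h1 | h1
  · rw [abs_of_pos (riccatiS_pos n hx h1)]
    exact ((hd x hx h1).2.trans (pow_le_one₀ hx.le h1)).trans (le_max_left _ _)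
  · exact (hM x ⟨h1, hxc⟩).trans (le_max_right _ _)

/-- The wave function with interior wave number `k`, exterior one `κ` and exterior amplitude `C`. -/
noncomputable def wave (W : DeltaWell) (ℓ : ℕ) (k κ C : ℝ) (r : ℝ) : ℂ :=
  if r < W.R then (riccatiS ℓ (k * r) : ℝ) else (C * riccatiK ℓ (κ * r) : ℝ)

/-- One exponential $e^{-\kappa r}$ dominates both pieces: inside, the bounded factor is compensated
by $e^{\kappa R}$. -/
theorem wave_memLp (W : DeltaWell) (ℓ : ℕ) {k κ : ℝ} (C : ℝ) (hk : 0 < k) (hκ : 0 < κ) :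
    MemLp (W.wave ℓ k κ C) 2 (volume.restrict (Ioi (0 : ℝ))) := by
  have hR := W.R_pos
  obtain ⟨M, hM⟩ := riccatiS_bounded ℓ (k * W.R)
  obtain ⟨B, hB⟩ := riccatiK_le ℓ (mul_pos hκ hR)
  have hM0 : 0 ≤ M := (abs_nonneg _).trans (hM (k * W.R) (mul_pos hk hR) le_rfl)
  refine memLp_of_norm_le_exp (M := max (M * Real.exp (κ * W.R)) (|C| * B)) hκ ?_ fun r hr => ?_
  · have e : Ioo 0 W.R ∪ Ici W.R = Ioi 0 := Ioo_union_Ici_eq_Ioi hR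
    rw [← e, aestronglyMeasurable_union_iff]
    constructor
    · have : ContinuousOn (fun r => (riccatiS ℓ (k * r) : ℂ)) (Ioo 0 W.R) := fun r hr =>
        (hasDerivAt_scaled (fun hx => riccatiS_hasDerivAt hx ℓ) hk.ne'
          hr.1.ne').ofReal_comp.continuousAt.continuousWithinAt
      refine (this.congr fun r hr => ?_).aestronglyMeasurable measurableSet_Ioo
      simp [wave, hr.2]
    · have : ContinuousOn (fun r => ((C * riccatiK ℓ (κ * r) : ℝ) : ℂ)) (Ici W.R) := fun r hr =>
        ((hasDerivAt_scaled (fun hx => riccatiK_hasDerivAt hx ℓ) hκ.ne'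
          (hR.trans_le hr).ne').const_mul C).ofReal_comp.continuousAt.continuousWithinAt
      refine (this.congr fun r hr => ?_).aestronglyMeasurable measurableSet_Ici
      simp [wave, (mem_Ici.1 hr).not_gt]
  · by_cases hlt : r < W.R
    · rw [wave, if_pos hlt, Complex.norm_real, Real.norm_eq_abs]
      have h1 := hM (k * r) (mul_pos hk hr) (by gcongr)
      have h2 : 1 ≤ Real.exp (κ * W.R) * Real.exp (-κ * r) := by
        rw [← Real.exp_add, Real.one_le_exp_iff]
        nlinarith
      calc |riccatiS ℓ (k * r)| ≤ M * 1 := by rw [mul_one]; exact h1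
        _ ≤ M * (Real.exp (κ * W.R) * Real.exp (-κ * r)) := by gcongr
        _ = (M * Real.exp (κ * W.R)) * Real.exp (-κ * r) := by ring
        _ ≤ _ := by gcongr; exact le_max_left _ _
    · rw [wave, if_neg hlt, Complex.norm_real, Real.norm_eq_abs, abs_mul,
        abs_of_pos (riccatiK_pos ℓ (mul_pos hκ hr))]
      calc |C| * riccatiK ℓ (κ * r) ≤ |C| * (B * Real.exp (-(κ * r))) := by
            gcongr
            exact hB _ (by gcongr; exact not_lt.1 hlt)
        _ = (|C| * B) * Real.exp (-κ * r) := by rw [neg_mul]; ring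
        _ ≤ _ := by gcongr; exact le_max_right _ _

/-- The exterior amplitude is chosen to satisfy the condition on values, and the secular equation is
then the condition on derivatives. -/
theorem isBoundState_wave (W : DeltaWell) (hβ : W.β ≠ 2) (hβ' : W.β ≠ -2) {ℓ : ℕ} {ε : ℝ}
    (hε : ε ∈ Ioo (0 : ℝ) 1) (hS : riccatiS ℓ (W.v0 * √(1 - ε)) ≠ 0)
    (h : besselJRatio ℓ (W.v0 * √(1 - ε)) = secularRHS ℓ W.β W.w (W.v0 * √ε)) :
    W.IsBoundState ℓ (-(ε * W.V0)) (W.wave ℓ (W.v0 * √(1 - ε) / W.R) (W.v0 * √ε / W.R)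
      ((2 + W.β) / (2 - W.β) * riccatiS ℓ (W.v0 * √(1 - ε)) / riccatiK ℓ (W.v0 * √ε))) := by
  set χ := W.v0 * √(1 - ε) with hχe
  set σ := W.v0 * √ε with hσe
  have hR := W.R_pos
  have hχ : 0 < χ := mul_pos W.v0_pos (Real.sqrt_pos.2 (by linarith [hε.2]))
  have hσ : 0 < σ := mul_pos W.v0_pos (Real.sqrt_pos.2 hε.1)
  have hK := riccatiK_pos ℓ hσ
  set C := (2 + W.β) / (2 - W.β) * riccatiS ℓ χ / riccatiK ℓ σ with hCe
  set u := W.wave ℓ (χ / W.R) (σ / W.R) C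
  have hk : 0 < χ / W.R := div_pos hχ hR
  have hκ : 0 < σ / W.R := div_pos hσ hR
  have eχ := W.mul_R_cancel χ
  have eσ := W.mul_R_cancel σ
  have uin (r : ℝ) (hr : r < W.R) : u r = (riccatiS ℓ (χ / W.R * r) : ℝ) := if_pos hr
  have uout (r : ℝ) (hr : W.R < r) : u r = (C * riccatiK ℓ (σ / W.R * r) : ℝ) := if_neg hr.not_gt
  have hin := fun r hr => W.interior_hasDerivAt ℓ hε.2 (fun hx => riccatiS_hasDerivAt hx ℓ)
    (fun hx => riccatiS'_hasDerivAt hx ℓ) (congrArg (· / W.R) hχe) (r := r) hr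
  have hout := fun r hr => W.exterior_hasDerivAt ℓ hε.1 (fun hx => riccatiK_hasDerivAt hx ℓ)
    (fun hx => riccatiK'_hasDerivAt hx ℓ) (congrArg (· / W.R) hσe) (r := r) hr
  have sin := fun r hr => solution_of_eqOn (u := u) isOpen_Ioo (fun r hr => uin r hr.2)
    (fun r hr => (hin r hr).1) (fun r hr => (hin r hr).2) (r := r) hr
  have sout := fun r hr => solution_of_eqOn (u := u) isOpen_Ioi (fun r hr => uout r hr)
    (fun r hr => (hout r hr).1.const_mul C)
    (fun r hr => ((hout r hr).2.const_mul C).congr_deriv (mul_left_comm _ _ _)) (r := r) hr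
  refine ⟨?_, ?_, ?_, W.wave_memLp ℓ C hk hκ, ?_, ?_⟩
  -- A point this close to the origin has $\chi r/R\le1$, where $S_\ell$ is known to be positive.
  · have hm : 0 < min W.R (W.R / χ) := lt_min hR (div_pos hR hχ)
    have h1 : min W.R (W.R / χ) / 2 < W.R := by linarith [min_le_left W.R (W.R / χ)]
    refine ⟨min W.R (W.R / χ) / 2, by linarith, h1.ne, ?_⟩
    rw [uin _ h1]
    refine Complex.ofReal_ne_zero.2 (riccatiS_pos ℓ (by positivity) ?_).ne'
    calc χ / W.R * (min W.R (W.R / χ) / 2) ≤ χ / W.R * (W.R / χ) :=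
          mul_le_mul_of_nonneg_left (by linarith [min_le_right W.R (W.R / χ)]) hk.le
      _ = 1 := by field_simp
  · intro r hr0 hrR
    rcases lt_or_gt_of_ne hrR with hlt | hgt
    · exact (sin r ⟨hr0, hlt⟩).1
    · exact (sout r hgt).1
  · intro r hr0 hrR
    rcases lt_or_gt_of_ne hrR with hlt | hgt
    · exact (sin r ⟨hr0, hlt⟩).2.2
    · exact (sout r hgt).2.2
  · have h1 := (riccatiS_tendsto_zero ℓ).comp (tendsto_scaled_nhdsGT_zero hk)
    have h2 := (Complex.continuous_ofReal.tendsto 0).comp h1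
    rw [Complex.ofReal_zero] at h2
    refine h2.congr' ?_
    filter_upwards [Ioo_mem_nhdsGT hR] with r hr using (uin r hr.2).symm
  · have c1 : ContinuousAt (riccatiS ℓ) (χ / W.R * W.R) := by
      rw [eχ]; exact (riccatiS_hasDerivAt hχ.ne' ℓ).continuousAt
    have c2 : ContinuousAt (fun x => χ / W.R * riccatiS' ℓ x) (χ / W.R * W.R) := by
      rw [eχ]; exact ((riccatiS'_hasDerivAt hχ.ne' ℓ).const_mul _).continuousAt
    have c3 : ContinuousAt (fun x => C * riccatiK ℓ x) (σ / W.R * W.R) := by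
      rw [eσ]; exact ((riccatiK_hasDerivAt hσ.ne' ℓ).const_mul _).continuousAt
    have c4 : ContinuousAt (fun x => C * (σ / W.R * riccatiK' ℓ x)) (σ / W.R * W.R) := by
      rw [eσ]; exact (((riccatiK'_hasDerivAt hσ.ne' ℓ).const_mul _).const_mul _).continuousAt
    have l1 := (tendsto_scaled c1 1 (s := Iio W.R)).congr' (f₂ := u)
      (by filter_upwards [self_mem_nhdsWithin] with r hr; rw [one_mul, uin r hr])
    have l2 := (tendsto_scaled c2 1 (s := Iio W.R)).congr' (f₂ := deriv u)
      (by filter_upwards [Ioo_mem_nhdsLT hR] with r hr; rw [one_mul, (sin r hr).2.1])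
    have l3 := (tendsto_scaled c3 1 (s := Ioi W.R)).congr' (f₂ := u)
      (by filter_upwards [self_mem_nhdsWithin] with r hr; rw [one_mul, uout r hr])
    have l4 := (tendsto_scaled c4 1 (s := Ioi W.R)).congr' (f₂ := deriv u)
      (by filter_upwards [self_mem_nhdsWithin] with r hr; rw [one_mul, (sout r hr).2.1])
    rw [eχ, one_mul] at l1 l2
    rw [eσ, one_mul] at l3 l4
    refine ⟨_, _, _, _, l1, l2, l3, l4, ?_, ?_⟩
    · rw [← Complex.ofReal_mul, Complex.ofReal_inj, hCe, div_mul_cancel₀ _ hK.ne']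
    · rw [← Complex.ofReal_mul, ← Complex.ofReal_mul, ← Complex.ofReal_add, Complex.ofReal_inj]
      rw [secularRHS_eq _ _ _ hσ, besselJRatio, besselKRatio] at h
      have h1 := (matching_iff_secular hβ hβ' (ℓ + 1) W.w _ _).2 h
      have e4 : 4 - W.β ^ 2 ≠ 0 := by
        rw [show 4 - W.β ^ 2 = (2 - W.β) * (2 + W.β) by ring]
        exact mul_ne_zero (sub_ne_zero.2 hβ.symm) fun h => hβ' (by linarith)
      have e1 : χ / W.R * riccatiS' ℓ χ =
          riccatiS ℓ χ / W.R * (ℓ + 1 - χ * riccatiS (ℓ + 1) χ / riccatiS ℓ χ) := by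
        rw [riccatiS'_eq]
        field_simp
      have e2 : C * (σ / W.R * riccatiK' ℓ σ) = riccatiS ℓ χ / W.R *
          ((2 + W.β) / (2 - W.β) * (ℓ + 1 - σ * riccatiK (ℓ + 1) σ / riccatiK ℓ σ)) := by
        rw [riccatiK'_eq, hCe]
        generalize (2 + W.β) / (2 - W.β) = g
        field_simp
      have e3 : 4 * W.α / (4 - W.β ^ 2) * riccatiS ℓ χ =
          riccatiS ℓ χ / W.R * (W.w / (4 - W.β ^ 2)) := by
        rw [w]
        field_simp
      rw [e1, e2, e3, h1]
      ring

theorem mem_relativeEnergies_iff (W : DeltaWell) (hβ : W.β ≠ 2) (hβ' : W.β ≠ -2) {ℓ : ℕ} {ε : ℝ}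
    (hε : ε ∈ Ioo (0 : ℝ) 1) : ε ∈ W.relativeEnergies ℓ ↔ riccatiS ℓ (W.v0 * √(1 - ε)) ≠ 0 ∧
      besselJRatio ℓ (W.v0 * √(1 - ε)) = secularRHS ℓ W.β W.w (W.v0 * √ε) :=
  ⟨fun h => h.2.elim fun _ hu => hu.secular hβ hβ' hε,
    fun h => ⟨hε, _, W.isBoundState_wave hβ hβ' hε h.1 h.2⟩⟩

end DeltaWell

/-! ### Counting the roots of the secular equation branch by branch. -/

section Counting

/-- The difference of the two sides of a secular equation, with right-hand side `G`. -/
noncomputable def secularDiff (n : ℕ) (G : ℝ → ℝ) (v x : ℝ) : ℝ :=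
  besselJRatio n x - G √(v ^ 2 - x ^ 2)

theorem sqrt_sq_sub_sq_mem {v x : ℝ} (hx : x ∈ Ioo 0 v) : √(v ^ 2 - x ^ 2) ∈ Ioo 0 v := by
  have h : x ^ 2 < v ^ 2 := pow_lt_pow_left₀ hx.2 hx.1.le two_ne_zero
  have h' : 0 < x ^ 2 := pow_pos hx.1 2
  refine ⟨Real.sqrt_pos.2 (by linarith), ?_⟩
  rw [Real.sqrt_lt' (hx.1.trans hx.2)]
  linarith

variable {n : ℕ} {G : ℝ → ℝ} {g v : ℝ}

/-- As $x$ grows, $\sqrt{v^2-x^2}$ decreases, so $-G$ of it increases along with the quotient. -/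
theorem secularDiff_strictMonoOn (hG : StrictMonoOn G (Ioi 0)) {a b : ℝ} (ha : 0 ≤ a) (hb : b ≤ v)
    (h : ∀ x ∈ Ioo a b, riccatiS n x ≠ 0) : StrictMonoOn (secularDiff n G v) (Ioo a b) := by
  intro x hx y hy hxy
  have hx0 : x ∈ Ioo 0 v := ⟨ha.trans_lt hx.1, hx.2.trans_le hb⟩
  have hy0 : y ∈ Ioo 0 v := ⟨ha.trans_lt hy.1, hy.2.trans_le hb⟩
  have h1 := besselJRatio_strictMonoOn ha h hx hy hxy
  have h2 : √(v ^ 2 - y ^ 2) < √(v ^ 2 - x ^ 2) := by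
    refine Real.sqrt_lt_sqrt (Real.sqrt_pos.1 (sqrt_sq_sub_sq_mem hy0).1).le ?_
    have : x ^ 2 < y ^ 2 := pow_lt_pow_left₀ hxy hx0.1.le two_ne_zero
    linarith
  have h3 := hG (sqrt_sq_sub_sq_mem hy0).1 (sqrt_sq_sub_sq_mem hx0).1 h2
  simp only [secularDiff]
  linarith

theorem secularDiff_continuousOn (hG : ContinuousOn G (Ioi 0)) {a b : ℝ} (ha : 0 ≤ a) (hb : b ≤ v)
    (h : ∀ x ∈ Ioo a b, riccatiS n x ≠ 0) : ContinuousOn (secularDiff n G v) (Ioo a b) := by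
  refine ContinuousOn.sub (fun x hx => ?_) (hG.comp (by fun_prop) fun x hx => ?_)
  · exact (besselJRatio_continuousAt (ha.trans_lt hx.1) (h x hx)).continuousWithinAt
  · exact (sqrt_sq_sub_sq_mem ⟨ha.trans_lt hx.1, hx.2.trans_le hb⟩).1

/-- The bound $G(\sigma)<G(v)$ is uniform along the arc, so the pole prevails even when $z=v$. -/
theorem secularDiff_eventually_pos (hG : StrictMonoOn G (Ioi 0)) {z : ℝ} (hz : 0 < z) (hzv : z ≤ v)
    (h : riccatiS n z = 0) : ∀ᶠ x in 𝓝[<] z, 0 < secularDiff n G v x := by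
  filter_upwards [(besselJRatio_tendsto_atTop hz h).eventually (eventually_gt_atTop (G v)),
    Ioo_mem_nhdsLT hz] with x hx hxI
  have hm := sqrt_sq_sub_sq_mem (v := v) ⟨hxI.1, hxI.2.trans_le hzv⟩
  have := hG hm.1 (hz.trans_le hzv) hm.2
  rw [secularDiff]
  linarith

theorem lt_of_strictMonoOn_Ioi_of_tendsto (hG : StrictMonoOn G (Ioi 0))
    (hg : Tendsto G (𝓝[>] 0) (𝓝 g)) {x : ℝ} (hx : 0 < x) : g < G x :=
  lt_of_strictMonoOn_of_tendsto (b := x + 1) (hG.mono Ioo_subset_Ioi_self) hg ⟨hx, by linarith⟩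

theorem secularDiff_eventually_neg (hG : StrictMonoOn G (Ioi 0)) (hg : Tendsto G (𝓝[>] 0) (𝓝 g))
    {a : ℝ} (ha : 0 ≤ a) (hav : a < v) (h : ∀ᶠ x in 𝓝[>] a, besselJRatio n x < g) :
    ∀ᶠ x in 𝓝[>] a, secularDiff n G v x < 0 := by
  filter_upwards [h, Ioo_mem_nhdsGT hav] with x hx hxI
  have hm := sqrt_sq_sub_sq_mem (v := v) ⟨ha.trans_lt hxI.1, hxI.2⟩
  have := lt_of_strictMonoOn_Ioi_of_tendsto hG hg hm.1
  rw [secularDiff]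
  linarith

theorem secularDiff_tendsto_zero (hG : ContinuousOn G (Ioi 0)) (hv : 0 < v) :
    Tendsto (secularDiff n G v) (𝓝[>] 0) (𝓝 (-G v)) := by
  have h1 : Tendsto (fun x : ℝ => √(v ^ 2 - x ^ 2)) (𝓝[>] 0) (𝓝 v) := by
    have : Continuous (fun x : ℝ => √(v ^ 2 - x ^ 2)) := by fun_prop
    have := tendsto_nhdsWithin_of_tendsto_nhds (s := Ioi 0) (this.tendsto 0)
    simpa [Real.sqrt_sq hv.le] using this
  have h2 := ((hG.continuousAt (Ioi_mem_nhds hv)).tendsto.comp h1)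
  have := (besselJRatio_tendsto_zero n).sub h2
  rwa [zero_sub] at this

theorem secularDiff_tendsto_edge (hg : Tendsto G (𝓝[>] 0) (𝓝 g)) (hv : 0 < v)
    (h : riccatiS n v ≠ 0) :
    Tendsto (secularDiff n G v) (𝓝[<] v) (𝓝 (besselJRatio n v - g)) := by
  have h1 : Tendsto (fun x : ℝ => √(v ^ 2 - x ^ 2)) (𝓝[<] v) (𝓝[>] 0) := by
    refine tendsto_nhdsWithin_iff.2 ⟨?_, ?_⟩
    · have : Continuous (fun x : ℝ => √(v ^ 2 - x ^ 2)) := by fun_prop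
      have := tendsto_nhdsWithin_of_tendsto_nhds (s := Iio v) (this.tendsto v)
      simpa using this
    · filter_upwards [Ioo_mem_nhdsLT hv] with x hx using (sqrt_sq_sub_sq_mem hx).1
  exact (tendsto_nhdsWithin_of_tendsto_nhds (besselJRatio_continuousAt hv h).tendsto).sub
    (hg.comp h1)

/-- The solutions of the secular equation between `a` and `b`. -/
noncomputable def secularRoots (n : ℕ) (G : ℝ → ℝ) (v a b : ℝ) : Set ℝ :=
  {x | x ∈ Ioo a b ∧ riccatiS n x ≠ 0 ∧ secularDiff n G v x = 0}

theorem secularRoots_eq_singleton (hG : StrictMonoOn G (Ioi 0)) (hGc : ContinuousOn G (Ioi 0))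
    {a b : ℝ} (ha : 0 ≤ a) (hab : a < b) (hb : b ≤ v) (h : ∀ x ∈ Ioo a b, riccatiS n x ≠ 0)
    (hl : ∀ᶠ x in 𝓝[>] a, secularDiff n G v x < 0)
    (hr : ∀ᶠ x in 𝓝[<] b, 0 < secularDiff n G v x) : ∃ x, secularRoots n G v a b = {x} := by
  obtain ⟨p, hp, hpI⟩ := (hl.and (Ioo_mem_nhdsGT hab)).exists
  obtain ⟨q, hq, hqI⟩ := (hr.and (Ioo_mem_nhdsLT hab)).exists
  obtain ⟨x, hx, hx0⟩ := isPreconnected_Ioo.intermediate_value hpI hqI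
    (secularDiff_continuousOn hGc ha hb h) ⟨hp.le, hq.le⟩
  refine ⟨x, eq_singleton_iff_unique_mem.2 ⟨⟨hx, h x hx, hx0⟩, fun y hy => ?_⟩⟩
  exact (secularDiff_strictMonoOn hG ha hb h).injOn hy.1 hx (hy.2.2.trans hx0.symm)

theorem secularRoots_eq_empty_of_left (hG : StrictMonoOn G (Ioi 0)) {a b l : ℝ} (ha : 0 ≤ a)
    (hb : b ≤ v) (h : ∀ x ∈ Ioo a b, riccatiS n x ≠ 0)
    (hl : Tendsto (secularDiff n G v) (𝓝[>] a) (𝓝 l)) (hl0 : 0 ≤ l) :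
    secularRoots n G v a b = ∅ :=
  eq_empty_of_forall_notMem fun _ hx => (hl0.trans_lt (lt_of_strictMonoOn_of_tendsto
    (secularDiff_strictMonoOn hG ha hb h) hl hx.1)).ne' hx.2.2

theorem secularRoots_eq_empty_of_right (hG : StrictMonoOn G (Ioi 0)) {a b l : ℝ} (ha : 0 ≤ a)
    (hb : b ≤ v) (h : ∀ x ∈ Ioo a b, riccatiS n x ≠ 0)
    (hl : Tendsto (secularDiff n G v) (𝓝[<] b) (𝓝 l)) (hl0 : l ≤ 0) :
    secularRoots n G v a b = ∅ :=
  eq_empty_of_forall_notMem fun _ hx => ((lt_of_strictMonoOn_of_tendsto_left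
    (secularDiff_strictMonoOn hG ha hb h) hl hx.1).trans_le hl0).ne hx.2.2

/-- The dividing point is a zero of $S_n$ and hence never a root, so no root is lost between the two
open intervals. -/
theorem secularRoots_union {a z b : ℝ} (haz : a ≤ z) (hzb : z ≤ b) (hz : riccatiS n z = 0) :
    secularRoots n G v a b = secularRoots n G v a z ∪ secularRoots n G v z b := by
  ext x
  constructor
  · intro hx
    rcases lt_trichotomy x z with h | h | h
    · exact Or.inl ⟨⟨hx.1.1, h⟩, hx.2⟩
    · exact absurd (h ▸ hz) hx.2.1
    · exact Or.inr ⟨⟨h, hx.1.2⟩, hx.2⟩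
  · rintro (hx | hx)
    · exact ⟨⟨hx.1.1, hx.1.2.trans_le hzb⟩, hx.2⟩
    · exact ⟨⟨haz.trans_lt hx.1.1, hx.1.2⟩, hx.2⟩

theorem secularRoots_disjoint (a z b : ℝ) :
    Disjoint (secularRoots n G v a z) (secularRoots n G v z b) :=
  Set.disjoint_left.2 fun _ hx hx' => (hx.1.2.trans hx'.1.1).false

theorem secularRoots_union_ncard {a z b : ℝ} (haz : a ≤ z) (hzb : z ≤ b) (hz : riccatiS n z = 0)
    (h1 : (secularRoots n G v a z).Finite) (h2 : (secularRoots n G v z b).Finite) :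
    (secularRoots n G v a b).Finite ∧ (secularRoots n G v a b).ncard =
      (secularRoots n G v a z).ncard + (secularRoots n G v z b).ncard := by
  rw [secularRoots_union haz hzb hz]
  exact ⟨h1.union h2, ncard_union_eq (secularRoots_disjoint a z b) h1 h2⟩

theorem finite_ncard_of_singleton {s : Set ℝ} (h : ∃ x, s = {x}) : s.Finite ∧ s.ncard = 1 := by
  obtain ⟨x, rfl⟩ := h
  exact ⟨finite_singleton x, ncard_singleton x⟩

theorem finite_ncard_of_empty {s : Set ℝ} (h : s = ∅) : s.Finite ∧ s.ncard = 0 := by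
  rw [h]
  exact ⟨finite_empty, ncard_empty ℝ⟩

/-- The difference rises from $-G(v)$ to $+\infty$, so a root exists exactly when $G(v)>0$. -/
theorem secularRoots_first (hG : StrictMonoOn G (Ioi 0)) (hGc : ContinuousOn G (Ioi 0))
    (hv : besselJZero (n + 1 / 2) 1 ≤ v) (hGv : G v ≠ 0) :
    (secularRoots n G v 0 (besselJZero (n + 1 / 2) 1)).Finite ∧
    ((secularRoots n G v 0 (besselJZero (n + 1 / 2) 1)).ncard : ℤ) =
      1 - if 0 > G v then 1 else 0 := by
  have hz := besselJZero_half_pos n 0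
  have hne : ∀ x ∈ Ioo 0 (besselJZero (n + 1 / 2) 1), riccatiS n x ≠ 0 :=
    fun x hx => riccatiS_ne_zero_of_mem_Ioo (s := 0) hx
  have hlim := secularDiff_tendsto_zero (n := n) hGc (hz.trans_le hv)
  rcases hGv.lt_or_gt with h | h
  · have := finite_ncard_of_empty
      (secularRoots_eq_empty_of_left hG le_rfl hv hne hlim (by linarith))
    exact ⟨this.1, by rw [this.2, if_pos (show 0 > G v from h)]; rfl⟩
  · have := finite_ncard_of_singleton (secularRoots_eq_singleton hG hGc le_rfl hz hv hne
      (hlim.eventually (gt_mem_nhds (by linarith)))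
      (secularDiff_eventually_pos hG hz hv (riccatiS_besselJZero n 0)))
    exact ⟨this.1, by rw [this.2, if_neg (show ¬ 0 > G v from h.le.not_gt)]; rfl⟩

theorem secularRoots_middle (hG : StrictMonoOn G (Ioi 0)) (hGc : ContinuousOn G (Ioi 0))
    (hg : Tendsto G (𝓝[>] 0) (𝓝 g)) {s : ℕ} (hv : besselJZero (n + 1 / 2) (s + 2) ≤ v) :
    ∃ x, secularRoots n G v (besselJZero (n + 1 / 2) (s + 1))
      (besselJZero (n + 1 / 2) (s + 2)) = {x} := by
  have hz := besselJZero_half_pos n s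
  have hlt := besselJZero_half_strictMono n (s + 1).lt_succ_self
  exact secularRoots_eq_singleton hG hGc hz.le hlt hv
    (fun x hx => riccatiS_ne_zero_of_mem_Ioo hx)
    (secularDiff_eventually_neg hG hg hz.le (hlt.trans_le hv)
      ((besselJRatio_tendsto_atBot hz (riccatiS_besselJZero n s)).eventually
        (eventually_lt_atBot g)))
    (secularDiff_eventually_pos hG (besselJZero_half_pos n (s + 1)) hv
      (riccatiS_besselJZero n (s + 1)))

theorem secularRoots_upto_zero (hG : StrictMonoOn G (Ioi 0)) (hGc : ContinuousOn G (Ioi 0))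
    (hg : Tendsto G (𝓝[>] 0) (𝓝 g)) (hGv : G v ≠ 0) (s : ℕ)
    (hv : besselJZero (n + 1 / 2) (s + 1) ≤ v) :
    (secularRoots n G v 0 (besselJZero (n + 1 / 2) (s + 1))).Finite ∧
    ((secularRoots n G v 0 (besselJZero (n + 1 / 2) (s + 1))).ncard : ℤ) =
      (s + 1 : ℕ) - if 0 > G v then 1 else 0 := by
  induction s with
  | zero => simpa using secularRoots_first hG hGc hv hGv
  | succ s ih =>
    have hlt := besselJZero_half_strictMono n (s + 1).lt_succ_self
    obtain ⟨h1, h2⟩ := ih (hlt.le.trans hv)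
    obtain ⟨h3, h4⟩ := finite_ncard_of_singleton (secularRoots_middle hG hGc hg hv)
    obtain ⟨h5, h6⟩ := secularRoots_union_ncard (besselJZero_half_pos n s).le hlt.le
      (riccatiS_besselJZero n s) h1 h3
    refine ⟨h5, ?_⟩
    rw [h6, Nat.cast_add, h2, h4]
    push_cast
    ring

/-- On the branch cut off at $v$ the difference rises from $-\infty$ to $\varphi(v)-g$. -/
theorem secularRoots_last (hG : StrictMonoOn G (Ioi 0)) (hGc : ContinuousOn G (Ioi 0))
    (hg : Tendsto G (𝓝[>] 0) (𝓝 g)) {s : ℕ} (hz : besselJZero (n + 1 / 2) (s + 1) < v)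
    (hv : v < besselJZero (n + 1 / 2) (s + 2)) (hne : besselJRatio n v ≠ g) :
    (secularRoots n G v (besselJZero (n + 1 / 2) (s + 1)) v).Finite ∧
    ((secularRoots n G v (besselJZero (n + 1 / 2) (s + 1)) v).ncard : ℤ) =
      if besselJRatio n v > g then 1 else 0 := by
  have hz0 := besselJZero_half_pos n s
  have hS : riccatiS n v ≠ 0 := riccatiS_ne_zero_of_mem_Ioo ⟨hz, hv⟩
  have hI : ∀ x ∈ Ioo (besselJZero (n + 1 / 2) (s + 1)) v, riccatiS n x ≠ 0 :=
    fun x hx => riccatiS_ne_zero_of_mem_Ioo ⟨hx.1, hx.2.trans hv⟩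
  have hlim := secularDiff_tendsto_edge hg (hz0.trans hz) hS
  rcases hne.lt_or_gt with h | h
  · have := finite_ncard_of_empty
      (secularRoots_eq_empty_of_right hG hz0.le le_rfl hI hlim (by linarith))
    exact ⟨this.1, by rw [this.2, if_neg h.le.not_gt]; rfl⟩
  · have := finite_ncard_of_singleton (secularRoots_eq_singleton hG hGc hz0.le hz le_rfl hI
      (secularDiff_eventually_neg hG hg hz0.le hz
        ((besselJRatio_tendsto_atBot hz0 (riccatiS_besselJZero n s)).eventually
          (eventually_lt_atBot g)))
      (hlim.eventually (lt_mem_nhds (by linarith))))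
    exact ⟨this.1, by rw [this.2, if_pos h]; rfl⟩

theorem secularRoots_only (hG : StrictMonoOn G (Ioi 0)) (hGc : ContinuousOn G (Ioi 0))
    (hg : Tendsto G (𝓝[>] 0) (𝓝 g)) (hv : 0 < v) (hv1 : v < besselJZero (n + 1 / 2) 1)
    (hGv : G v ≠ 0) (hne : besselJRatio n v ≠ g) :
    (secularRoots n G v 0 v).Finite ∧ ((secularRoots n G v 0 v).ncard : ℤ) =
      (if besselJRatio n v > g then 1 else 0) - if 0 > G v then 1 else 0 := by
  have hI : ∀ x ∈ Ioo 0 v, riccatiS n x ≠ 0 :=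
    fun x hx => riccatiS_ne_zero_of_mem_Ioo (s := 0) ⟨hx.1, hx.2.trans hv1⟩
  have hS : riccatiS n v ≠ 0 := riccatiS_ne_zero_of_mem_Ioo (s := 0) ⟨hv, hv1⟩
  have hlim0 := secularDiff_tendsto_zero (n := n) hGc hv
  have hlim := secularDiff_tendsto_edge hg hv hS
  -- If $G(v)<0$, then $g<G(v)<0<\varphi(v)$. Both corrections equal $1$ and cancel, in agreement
  -- with the absence of roots.
  have hpos : 0 < besselJRatio n v := lt_of_strictMonoOn_of_tendsto
    (besselJRatio_strictMonoOn_zeros n 0) (besselJRatio_tendsto_zero n) ⟨hv, hv1⟩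
  have hgv : g < G v := lt_of_strictMonoOn_Ioi_of_tendsto hG hg hv
  rcases hGv.lt_or_gt with h | h
  · have := finite_ncard_of_empty
      (secularRoots_eq_empty_of_left hG le_rfl le_rfl hI hlim0 (by linarith))
    exact ⟨this.1, by rw [this.2,
      if_pos (hgv.trans (h.trans hpos)), if_pos (show 0 > G v from h)]; rfl⟩
  · rcases hne.lt_or_gt with h' | h'
    · have := finite_ncard_of_empty
        (secularRoots_eq_empty_of_right hG le_rfl le_rfl hI hlim (by linarith))
      exact ⟨this.1, by
        rw [this.2, if_neg h'.le.not_gt, if_neg (show ¬ 0 > G v from h.le.not_gt)]; rfl⟩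
    · have := finite_ncard_of_singleton (secularRoots_eq_singleton hG hGc le_rfl hv le_rfl hI
        (hlim0.eventually (gt_mem_nhds (by linarith)))
        (hlim.eventually (lt_mem_nhds (by linarith))))
      exact ⟨this.1, by
        rw [this.2, if_pos h', if_neg (show ¬ 0 > G v from h.le.not_gt)]; rfl⟩

/-- The number of solutions of the secular equation. -/
theorem secularRoots_count (hG : StrictMonoOn G (Ioi 0)) (hGc : ContinuousOn G (Ioi 0))
    (hg : Tendsto G (𝓝[>] 0) (𝓝 g)) (hv : 0 < v) {M : ℕ} (hM : besselJZero (n + 1 / 2) M ≤ v)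
    (hM' : v < besselJZero (n + 1 / 2) (M + 1)) (hGv : G v ≠ 0)
    (hne : v ≠ besselJZero (n + 1 / 2) M → besselJRatio n v ≠ g) :
    (secularRoots n G v 0 v).Finite ∧ ((secularRoots n G v 0 v).ncard : ℤ) =
      M + (if v ≠ besselJZero (n + 1 / 2) M ∧ besselJRatio n v > g then 1 else 0) -
        if 0 > G v then 1 else 0 := by
  rcases M with _ | s
  · have hv0 : v ≠ besselJZero (n + 1 / 2) 0 := hv.ne'
    have := secularRoots_only hG hGc hg hv hM' hGv (hne hv0)
    simp only [hv0, ne_eq, not_false_eq_true, true_and, Nat.cast_zero, zero_add]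
    exact this
  · obtain ⟨h1, h2⟩ := secularRoots_upto_zero hG hGc hg hGv s hM
    -- When $v$ is itself a zero there is no cut-off branch, whatever value the quotient takes
    -- there.
    rcases hM.eq_or_lt with h | h
    · rw [h] at h1 h2
      refine ⟨h1, ?_⟩
      rw [h2, if_neg (show ¬ (v ≠ besselJZero (n + 1 / 2) (s + 1) ∧
        besselJRatio n v > g) from fun h' => h'.1 h.symm), add_zero]
    · obtain ⟨h3, h4⟩ := secularRoots_last hG hGc hg h hM' (hne h.ne')
      obtain ⟨h5, h6⟩ := secularRoots_union_ncard (besselJZero_half_pos n s).le h.le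
        (riccatiS_besselJZero n s) h1 h3
      refine ⟨h5, ?_⟩
      rw [h6, Nat.cast_add, h2, h4]
      simp only [h.ne', ne_eq, not_false_eq_true, true_and]
      ring

/-- Under a positivity condition there is one solution of the secular equation between
consecutive zeros of the two Bessel functions. -/
theorem secularRoots_interlaced (hG : StrictMonoOn G (Ioi 0)) (hGc : ContinuousOn G (Ioi 0))
    (hg : Tendsto G (𝓝[>] 0) (𝓝 g)) (hg0 : 0 < g) {s : ℕ}
    (hv : besselJZero (n + 1 / 2) (s + 1) ≤ v) :
    ∃ x, secularRoots n G v (besselJZero ((n + 1 : ℕ) + 1 / 2) s)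
      (besselJZero (n + 1 / 2) (s + 1)) = {x} := by
  obtain ⟨h1, h2, h3⟩ := besselJZero_interlacing n s
  have hy := besselJZero_half_nonneg (n + 1) s
  exact secularRoots_eq_singleton hG hGc hy h2 hv
    (fun x hx => riccatiS_ne_zero_of_mem_Ioo ⟨h1.trans_lt hx.1, hx.2⟩)
    -- At the left end the quotient tends to $0<g$, while $G$ exceeds $g$ throughout.
    (secularDiff_eventually_neg hG hg hy (h2.trans_le hv) (h3.eventually (gt_mem_nhds hg0)))
    (secularDiff_eventually_pos hG (besselJZero_half_pos n s) hv (riccatiS_besselJZero n s))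

end Counting

/-! ### The right-hand side of the secular equation. -/

section SecularRHS

variable {ℓ : ℕ} {β w : ℝ}

theorem secularRHS_strictMonoOn (hβ : β ≠ 2) (hβ' : β ≠ -2) :
    StrictMonoOn (secularRHS ℓ β w) (Ioi 0) := by
  intro x hx y hy hxy
  have h1 : 2 - β ≠ 0 := sub_ne_zero.2 hβ.symm
  have h2 : 2 + β ≠ 0 := fun h => hβ' (by linarith)
  have hc : 0 < (2 + β) ^ 2 / (2 - β) ^ 2 := by positivity
  have := mul_lt_mul_of_pos_left ((besselKRatio_strictMonoOn ℓ).1 hx hy hxy) hc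
  rw [secularRHS_eq _ _ _ hx, secularRHS_eq _ _ _ hy]
  linarith

theorem secularRHS_continuousOn : ContinuousOn (secularRHS ℓ β w) (Ioi 0) := by
  have h := (((besselKRatio_continuousOn ℓ).const_mul ((2 + β) ^ 2 / (2 - β) ^ 2)).sub
    (continuousOn_const (c := 8 * β * (ℓ + 1) / (2 - β) ^ 2))).add
      (continuousOn_const (c := w / (2 - β) ^ 2))
  exact h.congr fun x hx => secularRHS_eq ℓ β w hx

/-- The quotient of $K$'s tends to $2\ell+1$. In this form the lower bound on $w$ in the main
theorem says that the limit is positive. -/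
theorem secularRHS_tendsto (hβ : β ≠ 2) : Tendsto (secularRHS ℓ β w) (𝓝[>] 0)
    (𝓝 (((β - 2) ^ 2 + 2 * ℓ * (β ^ 2 + 4) + w) / (2 - β) ^ 2)) := by
  have h := (((besselKRatio_tendsto ℓ).const_mul
    ((2 + β) ^ 2 / (2 - β) ^ 2)).sub_const (8 * β * (ℓ + 1) / (2 - β) ^ 2)).add_const
      (w / (2 - β) ^ 2)
  have e : (2 + β) ^ 2 / (2 - β) ^ 2 * (2 * ℓ + 1) - 8 * β * (ℓ + 1) / (2 - β) ^ 2 +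
      w / (2 - β) ^ 2 = ((β - 2) ^ 2 + 2 * ℓ * (β ^ 2 + 4) + w) / (2 - β) ^ 2 := by
    have h1 : 2 - β ≠ 0 := sub_ne_zero.2 hβ.symm
    field_simp
    ring
  rw [e] at h
  refine h.congr' ?_
  filter_upwards [self_mem_nhdsWithin] with x hx using (secularRHS_eq ℓ β w hx).symm

end SecularRHS

/-! ### From roots in $\chi$ to relative energies. -/

namespace DeltaWell

theorem secularDiff_eq_zero_iff (W : DeltaWell) (ℓ : ℕ) {ε : ℝ} (hε : ε ∈ Ioo (0 : ℝ) 1) :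
    secularDiff ℓ (secularRHS ℓ W.β W.w) W.v0 (W.v0 * √(1 - ε)) = 0 ↔
      besselJRatio ℓ (W.v0 * √(1 - ε)) = secularRHS ℓ W.β W.w (W.v0 * √ε) := by
  have e : √(W.v0 ^ 2 - (W.v0 * √(1 - ε)) ^ 2) = W.v0 * √ε := by
    rw [mul_pow, Real.sq_sqrt (by linarith [hε.2]), show W.v0 ^ 2 - W.v0 ^ 2 * (1 - ε) =
      W.v0 ^ 2 * ε by ring, Real.sqrt_mul (sq_nonneg _), Real.sqrt_sq W.v0_pos.le]
  rw [secularDiff, e, sub_eq_zero]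

theorem chi_mem (W : DeltaWell) {ε : ℝ} (hε : ε ∈ Ioo (0 : ℝ) 1) :
    W.v0 * √(1 - ε) ∈ Ioo 0 W.v0 := by
  have h1 : 0 < √(1 - ε) := Real.sqrt_pos.2 (by linarith [hε.2])
  have h2 : √(1 - ε) < 1 := by
    rw [Real.sqrt_lt' one_pos]
    linarith [hε.1]
  exact ⟨mul_pos W.v0_pos h1, mul_lt_of_lt_one_right W.v0_pos h2⟩

theorem chi_of_epsilon (W : DeltaWell) {x : ℝ} (hx : 0 ≤ x) :
    W.v0 * √(1 - (1 - x ^ 2 / W.v0 ^ 2)) = x := by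
  have := W.v0_pos
  rw [sub_sub_cancel, ← div_pow, Real.sqrt_sq (by positivity)]
  field_simp

theorem epsilon_of_chi (W : DeltaWell) {ε : ℝ} (hε : ε ≤ 1) :
    1 - (W.v0 * √(1 - ε)) ^ 2 / W.v0 ^ 2 = ε := by
  have := W.v0_pos
  rw [mul_pow, Real.sq_sqrt (by linarith)]
  field_simp
  ring

theorem epsilon_lt_iff (W : DeltaWell) {x y : ℝ} (hx : 0 ≤ x) (hy : 0 ≤ y) :
    1 - x ^ 2 / W.v0 ^ 2 < 1 - y ^ 2 / W.v0 ^ 2 ↔ y < x := by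
  have := W.v0_pos
  rw [sub_lt_sub_iff_left, div_lt_div_iff_of_pos_right (by positivity), sq_lt_sq₀ hy hx]

theorem epsilon_mem (W : DeltaWell) {x : ℝ} (hx : x ∈ Ioo 0 W.v0) :
    1 - x ^ 2 / W.v0 ^ 2 ∈ Ioo (0 : ℝ) 1 := by
  have hv := W.v0_pos
  have h1 := (W.epsilon_lt_iff hv.le hx.1.le).2 hx.2
  have h2 := (W.epsilon_lt_iff hx.1.le le_rfl).2 hx.1
  rw [div_self (by positivity), sub_self] at h1
  simp only [ne_eq, OfNat.ofNat_ne_zero, not_false_eq_true, zero_pow, zero_div, sub_zero] at h2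
  exact ⟨h1, h2⟩

variable {W : DeltaWell} {ℓ : ℕ}

theorem epsilon_mem_relativeEnergies_iff (hβ : W.β ≠ 2) (hβ' : W.β ≠ -2) {x : ℝ}
    (hx : x ∈ Ioo 0 W.v0) : 1 - x ^ 2 / W.v0 ^ 2 ∈ W.relativeEnergies ℓ ↔
      x ∈ secularRoots ℓ (secularRHS ℓ W.β W.w) W.v0 0 W.v0 := by
  have hε := W.epsilon_mem hx
  rw [W.mem_relativeEnergies_iff hβ hβ' hε, ← W.secularDiff_eq_zero_iff ℓ hε,
    W.chi_of_epsilon hx.1.le]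
  exact ⟨fun h => ⟨hx, h⟩, fun h => h.2⟩

/-- The substitution $\chi=v_0\sqrt{1-\varepsilon}$ is a decreasing bijection of $(0,1)$ onto
$(0,v_0)$. -/
theorem relativeEnergies_eq_image (hβ : W.β ≠ 2) (hβ' : W.β ≠ -2) : W.relativeEnergies ℓ =
    (fun x => 1 - x ^ 2 / W.v0 ^ 2) '' secularRoots ℓ (secularRHS ℓ W.β W.w) W.v0 0 W.v0 := by
  ext ε
  constructor
  · intro h
    have hχ := W.chi_mem h.1
    have he := W.epsilon_of_chi h.1.2.le
    refine ⟨W.v0 * √(1 - ε), (epsilon_mem_relativeEnergies_iff hβ hβ' hχ).1 ?_, he⟩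
    rwa [he]
  · rintro ⟨x, hx, rfl⟩
    exact (epsilon_mem_relativeEnergies_iff hβ hβ' hx.1).2 hx

theorem numLevels_eq (hβ : W.β ≠ 2) (hβ' : W.β ≠ -2) : W.numLevels ℓ =
    (secularRoots ℓ (secularRHS ℓ W.β W.w) W.v0 0 W.v0).ncard := by
  rw [numLevels, relativeEnergies_eq_image hβ hβ']
  refine InjOn.ncard_image fun x hx y hy hxy => ?_
  have h1 : √(1 - (1 - x ^ 2 / W.v0 ^ 2)) = √(1 - (1 - y ^ 2 / W.v0 ^ 2)) :=
    congrArg (fun t => √(1 - t)) hxy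
  rw [← W.chi_of_epsilon hx.1.1.le, h1, W.chi_of_epsilon hy.1.1.le]

/-- One level between consecutive zeros. -/
theorem existsUnique_relativeEnergy (hβ : W.β ≠ 2) (hβ' : W.β ≠ -2) {a b : ℝ} (ha : 0 ≤ a)
    (hb0 : 0 ≤ b) (hb : b ≤ W.v0)
    (h : ∃ x, secularRoots ℓ (secularRHS ℓ W.β W.w) W.v0 a b = {x}) :
    ∃! ε : ℝ, ε ∈ W.relativeEnergies ℓ ∧
      ε ∈ Ioo (1 - b ^ 2 / W.v0 ^ 2) (1 - a ^ 2 / W.v0 ^ 2) := by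
  obtain ⟨x, hx⟩ := h
  have hxm : x ∈ secularRoots ℓ (secularRHS ℓ W.β W.w) W.v0 a b := by rw [hx]; rfl
  have hxI : x ∈ Ioo 0 W.v0 := ⟨ha.trans_lt hxm.1.1, hxm.1.2.trans_le hb⟩
  refine ⟨1 - x ^ 2 / W.v0 ^ 2, ⟨(epsilon_mem_relativeEnergies_iff hβ hβ' hxI).2 ⟨hxI, hxm.2⟩,
    (W.epsilon_lt_iff hb0 hxI.1.le).2 hxm.1.2, (W.epsilon_lt_iff hxI.1.le ha).2 hxm.1.1⟩, ?_⟩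
  rintro ε ⟨hε, hεI⟩
  have hχ := W.chi_mem hε.1
  have he := W.epsilon_of_chi hε.1.2.le
  rw [← he] at hε hεI ⊢
  have hr := (epsilon_mem_relativeEnergies_iff hβ hβ' hχ).1 hε
  have hm : W.v0 * √(1 - ε) ∈ secularRoots ℓ (secularRHS ℓ W.β W.w) W.v0 a b :=
    ⟨⟨(W.epsilon_lt_iff hχ.1.le ha).1 hεI.2, (W.epsilon_lt_iff hb0 hχ.1.le).1 hεI.1⟩, hr.2⟩
  rw [hx] at hm
  rw [mem_singleton_iff.1 hm]

end DeltaWell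

/-! ### The main theorem. -/

theorem theorem1 (W : DeltaWell) (hβ : W.β ≠ 2) (hβ' : W.β ≠ -2) (ℓ : ℕ) :
    -- bound states are the solutions of the secular equation
    (∀ ε ∈ Set.Ioo (0 : ℝ) 1, ε ∈ W.relativeEnergies ℓ ↔
      besselJ (ℓ + 1 / 2) (W.v0 * √(1 - ε)) ≠ 0 ∧
      secularLHS ℓ (W.v0 * √(1 - ε)) = secularRHS ℓ W.β W.w (W.v0 * √ε)) ∧
    -- one level in each interval
    (W.w > -((W.β - 2) ^ 2 + 2 * ℓ * (W.β ^ 2 + 4)) →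
      ∀ s : ℕ, 1 ≤ s → besselJZero (ℓ + 1 / 2) s ≤ W.v0 →
        Set.Ioo (1 - besselJZero (ℓ + 1 / 2) s ^ 2 / W.v0 ^ 2)
          (1 - besselJZero (ℓ + 3 / 2) (s - 1) ^ 2 / W.v0 ^ 2) ⊆ Set.Ioo 0 1 ∧
        ∃! ε : ℝ, ε ∈ W.relativeEnergies ℓ ∧
          ε ∈ Set.Ioo (1 - besselJZero (ℓ + 1 / 2) s ^ 2 / W.v0 ^ 2)
            (1 - besselJZero (ℓ + 3 / 2) (s - 1) ^ 2 / W.v0 ^ 2)) ∧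
    -- the number of bound states, for every real `w`
    (∃ (M : ℕ) (rhs0 : ℝ),
      IsLeast {s : ℕ | besselJZero (ℓ + 1 / 2) (s + 1) > W.v0} M ∧
      Filter.Tendsto (secularRHS ℓ W.β W.w) (nhdsWithin 0 (Set.Ioi 0)) (nhds rhs0) ∧
      ((W.v0 ≠ besselJZero (ℓ + 1 / 2) M → secularLHS ℓ W.v0 ≠ rhs0) →
        secularRHS ℓ W.β W.w W.v0 ≠ 0 →
        ∀ m m' : ℤ,
          m = (if W.v0 ≠ besselJZero (ℓ + 1 / 2) M ∧ secularLHS ℓ W.v0 > rhs0 then 1 else 0) →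
          m' = (if 0 > secularRHS ℓ W.β W.w W.v0 then 1 else 0) →
          (W.relativeEnergies ℓ).Finite ∧
          (W.numLevels ℓ : ℤ) = M + m - m' ∧
          (W.numBoundStates ℓ : ℤ) = (2 * ℓ + 1) * (M + m - m'))) := by
  have hG := secularRHS_strictMonoOn (ℓ := ℓ) (w := W.w) hβ hβ'
  have hGc := secularRHS_continuousOn (ℓ := ℓ) (β := W.β) (w := W.w)
  have hg := secularRHS_tendsto (ℓ := ℓ) (w := W.w) hβ
  have hv := W.v0_pos
  have hcast : ((ℓ : ℝ) + 3 / 2) = (ℓ + 1 : ℕ) + 1 / 2 := by push_cast; ring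
  refine ⟨fun ε hε => ?_, fun hw s hs hsv => ?_, ?_⟩
  · have hχ := (W.chi_mem hε).1
    rw [W.mem_relativeEnergies_iff hβ hβ' hε, ne_eq, ne_eq, besselJ_half_eq_zero_iff hχ,
      secularLHS_eq hχ]
    rfl
  · obtain ⟨s, rfl⟩ : ∃ t, s = t + 1 := ⟨s - 1, by omega⟩
    rw [Nat.add_sub_cancel, hcast]
    have hz := besselJZero_half_pos ℓ s
    have hy := besselJZero_half_nonneg (ℓ + 1) s
    have hc : (2 - W.β) ≠ 0 := sub_ne_zero.2 hβ.symm
    refine ⟨fun ε hε => ?_, DeltaWell.existsUnique_relativeEnergy hβ hβ' hy hz.le hsv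
      (secularRoots_interlaced hG hGc hg (div_pos (by linarith) (by positivity)) hsv)⟩
    have h1 : besselJZero (ℓ + 1 / 2) (s + 1) ^ 2 / W.v0 ^ 2 ≤ 1 := by
      rw [div_le_one (by positivity)]
      exact pow_le_pow_left₀ hz.le hsv 2
    have h2 : 0 ≤ besselJZero ((ℓ + 1 : ℕ) + 1 / 2) s ^ 2 / W.v0 ^ 2 := by positivity
    exact ⟨by linarith [hε.1], by linarith [hε.2]⟩
  · have hex : ∃ s, W.v0 < besselJZero (ℓ + 1 / 2) (s + 1) := exists_besselJZero_half_gt ℓ W.v0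
    classical
    -- Minimality gives $j_{\ell+1/2,M}\le v_0$ for $M\ge1$; for $M=0$ it is the convention
    -- $j_{\ell+1/2,0}=0$.
    have hM : besselJZero (ℓ + 1 / 2) (Nat.find hex) ≤ W.v0 := by
      rcases h : Nat.find hex with _ | s
      · exact hv.le
      · exact not_lt.1 (Nat.find_min hex (m := s) (by omega))
    refine ⟨Nat.find hex, _, ⟨Nat.find_spec hex, fun s hs => Nat.find_min' hex hs⟩, hg, ?_⟩
    intro hne hGv m m' hm hm'
    rw [secularLHS_eq hv] at hne hm
    obtain ⟨h1, h2⟩ := secularRoots_count hG hGc hg hv hM (Nat.find_spec hex) hGv hne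
    have h3 : (W.numLevels ℓ : ℤ) = Nat.find hex + m - m' := by
      rw [DeltaWell.numLevels_eq hβ hβ', h2, hm, hm']
      rfl
    refine ⟨?_, h3, ?_⟩
    · rw [DeltaWell.relativeEnergies_eq_image hβ hβ']
      exact h1.image _
    · rw [DeltaWell.numBoundStates, Nat.cast_mul, h3]
      push_cast
      ring
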